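/- Let $G$ be a discrete group and $H\le G$ a subgroup. For $p\in\{1,2,\infty\}$ let $\lambda^p\colon \ell^1(G)\to B(\ell^p(G/H))$ be the representation $(\lambda^p(f)g)(xH)=\sum_{y\in G}f(y)\,g(y^{-1}xH)$ of the convolution $*$-algebra $\ell^1(G)$, where $f^*(x)=\overline{f(x^{-1})}$. Let $\ell^1(G:H)=\ell^1(G)/\ker\lambda^2$ be the quotient $*$-algebra (one has $\ker\lambda^1=\ker\lambda^2=\ker\lambda^\infty$, a $*$-ideal), and write $[f]$ for the class of $f$. Let $PF^*_1(G:H)$ be the unital Banach $*$-algebra obtained by completing $\ell^1(G:H)$ in the norm $\|[f]\|=\max\{\|\lambda^1(f)\|,\|\lambda^\infty(f)\|\}$. Call the pair $(G,H)$ quasi-Hermitian if, for every finitely supported function $f\colon G\to\mathbb{C}$ with $[f]^*=[f]$, the spectrum of $[f]$ in $PF^*_1(G:H)$ is contained in $\mathbb{R}$. Theorem A. If $(G,H)$ is quasi-Hermitian, then $H$ is co-amenable in $G$: there is a positive linear functional $m$ on $\ell^\infty(G/H)$ with $m(1)=1$ and $m(y\cdot\varphi)=m(\varphi)$ for all $y\in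 G$ and $\varphi\in\ell^\infty(G/H)$, where $(y\cdot\varphi)(xH)=\varphi(y^{-1}xH)$. -/

import Mathlib

open scoped ENNReal ComplexOrder

noncomputable section

namespace GroupPair

/-! ### The left translations on `ℓ^p` of a `G`-set -/

section Translate

variable {G : Type*} [Group G] {X : Type*} [MulAction G X]

/-- Left translation on `ℓ^p(X)`, `1 ≤ p ≤ ∞`, by an element of a group acting on `X`:
`(y · g)(x) = g (y⁻¹ • x)`. -/
def translate (p : ℝ≥0∞) [hp : Fact (1 ≤ p)] (y : G) :
    lp (fun _ : X => ℂ) p →ₗᵢ[ℂ] lp (fun _ : X => ℂ) p where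
  toFun g := ⟨fun x => g (y⁻¹ • x), by
    have hg := lp.memℓp g
    rcases p.trichotomy with h | h | h
    · exact absurd hp.out (by simp [h])
    · subst h
      refine memℓp_infty ((memℓp_infty_iff.1 hg).mono ?_)
      rintro _ ⟨x, rfl⟩
      exact ⟨y⁻¹ • x, rfl⟩
    · exact (memℓp_gen_iff h).2 (((MulAction.toPerm y⁻¹ : Equiv.Perm X).summable_iff
        (f := fun x => ‖g x‖ ^ p.toReal)).2 ((memℓp_gen_iff h).1 hg))⟩
  map_add' _ _ := rfl
  map_smul' _ _ := rfl
  norm_map' g := by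
    rcases p.trichotomy with h | h | h
    · exact absurd hp.out (by simp [h])
    · subst h
      exact (MulAction.toPerm y⁻¹ : Equiv.Perm X).iSup_comp (g := fun x => ‖g x‖)
    · rw [lp.norm_eq_tsum_rpow h, lp.norm_eq_tsum_rpow h]
      congr 1
      exact (MulAction.toPerm y⁻¹ : Equiv.Perm X).tsum_eq (fun x => ‖g x‖ ^ p.toReal)

theorem translate_apply (p : ℝ≥0∞) [Fact (1 ≤ p)] (y : G) (g : lp (fun _ : X => ℂ) p) (x : X) :
    translate p y g x = g (y⁻¹ • x) := rfl

end Translate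

/-! ### The convolution `*`-algebra `ℓ¹(G)` -/

/-- The space `ℓ¹(G)` of a discrete group. -/
def L1 (G : Type*) : Type _ := lp (fun _ : G => ℂ) 1

namespace L1

variable {G : Type*}

instance : NormedAddCommGroup (L1 G) := inferInstanceAs (NormedAddCommGroup (lp (fun _ : G => ℂ) 1))
instance : NormedSpace ℂ (L1 G) := inferInstanceAs (NormedSpace ℂ (lp (fun _ : G => ℂ) 1))
instance : CompleteSpace (L1 G) := inferInstanceAs (CompleteSpace (lp (fun _ : G => ℂ) 1))
instance : FunLike (L1 G) G ℂ where
  coe f := Subtype.val (show lp (fun _ : G => ℂ) 1 from f)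
  coe_injective _ _ h := lp.ext h

theorem ext {f g : L1 G} (h : ∀ x, f x = g x) : f = g := DFunLike.ext f g h

theorem add_apply (f g : L1 G) (x : G) : (f + g) x = f x + g x := rfl
theorem smul_apply (c : ℂ) (f : L1 G) (x : G) : (c • f) x = c * f x := rfl
theorem zero_apply (x : G) : (0 : L1 G) x = 0 := rfl

theorem hasSum_norm (f : L1 G) : HasSum (fun x => ‖f x‖) ‖f‖ := by
  have h := lp.hasSum_norm (p := 1) (by simp) (show lp (fun _ : G => ℂ) 1 from f)
  simp only [ENNReal.toReal_one, Real.rpow_one] at h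
  exact h

/-- The point mass `δ_x`. -/
def single (x : G) : L1 G := by
  classical exact lp.single (E := fun _ : G => ℂ) 1 x 1

theorem single_apply_self (x : G) : single x x = 1 := by
  classical exact lp.single_apply_self 1 x 1

theorem single_apply_ne {x y : G} (h : y ≠ x) : single x y = 0 := by
  classical exact lp.single_apply_ne 1 x 1 h

/-- Summation of a uniformly bounded family against `ℓ¹` functions, `f ↦ ∑ f(y) T(y)`. -/
def sumAgainst {E : Type*} [NormedAddCommGroup E] [NormedSpace ℂ E] [CompleteSpace E]
    (T : G → E) (hT : ∀ y, ‖T y‖ ≤ 1) : L1 G →L[ℂ] E :=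
  have hn : ∀ (f : L1 G) (y : G), ‖f y • T y‖ ≤ ‖f y‖ := fun f y => by
    rw [norm_smul]
    exact mul_le_of_le_one_right (norm_nonneg _) (hT y)
  have hs : ∀ f : L1 G, Summable fun y => f y • T y := fun f =>
    Summable.of_norm_bounded f.hasSum_norm.summable (hn f)
  LinearMap.mkContinuous
    { toFun := fun f => ∑' y, f y • T y
      map_add' := fun f g => by
        rw [← (hs f).tsum_add (hs g)]
        exact tsum_congr fun y => by rw [add_apply, add_smul]
      map_smul' := fun c f => by
        rw [RingHom.id_apply, ← (hs f).tsum_const_smul c]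
        exact tsum_congr fun y => by rw [smul_apply, mul_smul] }
    1 (fun f => by
      rw [one_mul]
      exact tsum_of_norm_bounded f.hasSum_norm (hn f))

section SumAgainst

variable {E : Type*} [NormedAddCommGroup E] [NormedSpace ℂ E]

theorem hasSum_sumAgainst [CompleteSpace E] (T : G → E) (hT : ∀ y, ‖T y‖ ≤ 1) (f : L1 G) :
    HasSum (fun y => f y • T y) (sumAgainst T hT f) := by
  refine Summable.hasSum (Summable.of_norm_bounded f.hasSum_norm.summable fun y => ?_)
  rw [norm_smul]
  exact mul_le_of_le_one_right (norm_nonneg _) (hT y)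

theorem sumAgainst_single [CompleteSpace E] (T : G → E) (hT : ∀ y, ‖T y‖ ≤ 1) (y : G) :
    sumAgainst T hT (single y) = T y := by
  refine (hasSum_sumAgainst T hT (single y)).unique ?_
  have := hasSum_single (f := fun z => single y z • T z) y
    (fun z hz => by simp only [single_apply_ne hz, zero_smul])
  simpa only [single_apply_self, one_smul] using this

theorem clm_ext {A B : L1 G →L[ℂ] E} (h : ∀ y, A (single y) = B (single y)) : A = B := by
  classical
  ext f
  have hf : HasSum (fun y => f y • single y) f := by
    have := lp.hasSum_single (p := 1) (by simp) (show lp (fun _ : G => ℂ) 1 from f)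
    have he : ∀ y, f y • single y = (lp.single (E := fun _ : G => ℂ) 1 y (f y) : L1 G) := by
      refine fun y => L1.ext fun x => ?_
      by_cases hx : x = y
      · subst hx
        rw [smul_apply, single_apply_self, mul_one]
        exact (lp.single_apply_self (E := fun _ : G => ℂ) 1 x (f x)).symm
      · rw [smul_apply, single_apply_ne hx, mul_zero]
        exact (lp.single_apply_ne (E := fun _ : G => ℂ) 1 y (f y) hx).symm
    simp only [he]
    exact this
  have hA := hf.mapL A
  have hB := hf.mapL B
  simp only [map_smul, h] at hA hB
  exact hA.unique hB

end SumAgainst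

end L1

section Regular

variable {G : Type*} [Group G] {X : Type*} [MulAction G X]

/-- The representation of `ℓ¹(G)` on `ℓ^p(X)`, `λ(f) g = ∑_y f(y) (y · g)`. -/
def lam (X : Type*) [MulAction G X] (p : ℝ≥0∞) [Fact (1 ≤ p)] :
    L1 G →L[ℂ] (lp (fun _ : X => ℂ) p →L[ℂ] lp (fun _ : X => ℂ) p) :=
  L1.sumAgainst (fun y => (translate p y).toContinuousLinearMap)
    (fun y => (translate p y).norm_toContinuousLinearMap_le)

variable (p : ℝ≥0∞) [Fact (1 ≤ p)]

theorem hasSum_lam_apply (f : L1 G) (g : lp (fun _ : X => ℂ) p) (x : X) :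
    HasSum (fun y => f y * g (y⁻¹ • x)) (lam X p f g x) := by
  have h := L1.hasSum_sumAgainst (fun y : G => (translate (X := X) p y).toContinuousLinearMap)
    (fun y => (translate p y).norm_toContinuousLinearMap_le) f
  have h1 := h.mapL (ContinuousLinearMap.apply ℂ _ g)
  exact h1.mapL (lp.evalCLM ℂ (fun _ : X => ℂ) p x)

/-- The defining formula of the regular representation. -/
theorem lam_apply (f : L1 G) (g : lp (fun _ : X => ℂ) p) (x : X) :
    lam X p f g x = ∑' y, f y * g (y⁻¹ • x) :=
  (hasSum_lam_apply p f g x).tsum_eq.symm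

theorem lam_single (y : G) :
    lam X p (L1.single y) = (translate p y).toContinuousLinearMap :=
  L1.sumAgainst_single _ _ y

end Regular

namespace L1

variable {G : Type*} [Group G]

/-- Convolution: `(f * g)(x) = ∑_y f(y) g(y⁻¹ x)`. -/
instance : Mul (L1 G) := ⟨fun f g => lam G 1 f g⟩

instance : One (L1 G) := ⟨single 1⟩

theorem mul_def (f g : L1 G) : f * g = lam G 1 f g := rfl

theorem hasSum_mul_apply (f g : L1 G) (x : G) :
    HasSum (fun y => f y * g (y⁻¹ * x)) ((f * g) x) :=
  hasSum_lam_apply 1 f g x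

theorem mul_apply (f g : L1 G) (x : G) : (f * g) x = ∑' y, f y * g (y⁻¹ * x) :=
  lam_apply 1 f g x

theorem single_mul_single (y z : G) : single y * single z = single (y * z) := by
  rw [mul_def, lam_single]
  refine L1.ext fun x => ?_
  change single z (y⁻¹ * x) = single (y * z) x
  by_cases h : x = y * z
  · subst h
    rw [inv_mul_cancel_left, single_apply_self, single_apply_self]
  · rw [single_apply_ne h, single_apply_ne]
    rintro rfl
    exact h (by simp)

end L1

section Regular

variable {G : Type*} [Group G] {X : Type*} [MulAction G X] (p : ℝ≥0∞) [Fact (1 ≤ p)]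

theorem lam_mul (f g : L1 G) : lam X p (f * g) = (lam X p f).comp (lam X p g) := by
  have h1 : ∀ (z : G) (f : L1 G),
      lam X p (f * L1.single z) = (lam X p f).comp (lam X p (L1.single z)) := fun z f => by
    let A : L1 G →L[ℂ] L1 G :=
      (ContinuousLinearMap.apply ℂ (L1 G) (L1.single z)).comp (lam G 1)
    have := L1.clm_ext (A := (lam X p).comp A)
      (B := ((ContinuousLinearMap.compL ℂ _ _ _).flip (lam X p (L1.single z))).comp (lam X p))
      (fun y => by
        change lam X p (L1.single y * L1.single z)
          = (lam X p (L1.single y)).comp (lam X p (L1.single z))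
        rw [L1.single_mul_single, lam_single, lam_single, lam_single]
        ext g x
        change g ((y * z)⁻¹ • x) = g (z⁻¹ • y⁻¹ • x)
        rw [mul_inv_rev, mul_smul])
    exact congrArg (fun T => T f) this
  have := L1.clm_ext (A := (lam X p).comp (lam G 1 f))
    (B := (ContinuousLinearMap.compL ℂ _ _ _ (lam X p f)).comp (lam X p)) (fun z => h1 z f)
  exact congrArg (fun T => T g) this

theorem lam_one : lam X p (1 : L1 G) = ContinuousLinearMap.id ℂ _ := by
  change lam X p (L1.single 1) = _
  rw [lam_single]
  ext g x
  change g ((1 : G)⁻¹ • x) = g x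
  rw [inv_one, one_smul]

end Regular

namespace L1

variable {G : Type*} [Group G]

instance : Ring (L1 G) :=
  { (inferInstance : AddCommGroup (L1 G)), (inferInstance : Mul (L1 G)),
    (inferInstance : One (L1 G)) with
    left_distrib := fun f g h => map_add (lam G 1 f) g h
    right_distrib := fun f g h => by
      simp only [mul_def, map_add]; rfl
    zero_mul := fun f => by simp only [mul_def, map_zero]; rfl
    mul_zero := fun f => map_zero (lam G 1 f)
    mul_assoc := fun f g h => by
      rw [mul_def (f * g), lam_mul]; rfl
    one_mul := fun f => by
      rw [mul_def, lam_one]; rfl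
    mul_one := fun f => by
      have := L1.clm_ext (B := ContinuousLinearMap.id ℂ (L1 G))
        (A := (ContinuousLinearMap.apply ℂ (L1 G) (1 : L1 G)).comp (lam G 1))
        (fun y => by
          change L1.single y * L1.single 1 = L1.single y
          rw [single_mul_single, mul_one])
      exact congrArg (fun T => T f) this }

instance : Algebra ℂ (L1 G) :=
  Algebra.ofModule
    (fun c f g => by simp only [mul_def, map_smul]; rfl)
    (fun c f g => map_smul (lam G 1 f) c g)

/-- The involution `f*(x) = conj (f (x⁻¹))`. -/
instance : Star (L1 G) :=
  ⟨fun f => ⟨fun x => star (f x⁻¹), by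
    refine memℓp_gen ?_
    simp only [norm_star, ENNReal.toReal_one, Real.rpow_one]
    exact (Equiv.inv G).summable_iff.2 f.hasSum_norm.summable⟩⟩

theorem star_apply (f : L1 G) (x : G) : (star f) x = star (f x⁻¹) := rfl

instance : StarRing (L1 G) where
  star_involutive f := L1.ext fun x => by
    rw [star_apply, star_apply, inv_inv, star_star]
  star_add f g := L1.ext fun x => by
    rw [star_apply, add_apply, add_apply, star_add]; rfl
  star_mul f g := L1.ext fun x => by
    have h1 := (hasSum_mul_apply f g x⁻¹).star
    have h2 := hasSum_mul_apply (star g) (star f) x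
    rw [star_apply]
    refine h1.unique ?_
    rw [← (Equiv.mulLeft x).hasSum_iff] at h2
    convert h2 using 2 with z
    simp [star_apply, mul_comm]

instance : StarModule ℂ (L1 G) where
  star_smul c f := L1.ext fun x => by
    rw [star_apply, smul_apply, smul_apply, star_apply, star_mul']

/-- `ℂG`, the finitely supported functions, as a `*`-subalgebra of `ℓ¹(G)`. -/
def groupAlgebra (G : Type*) [Group G] : StarSubalgebra ℂ (L1 G) where
  carrier := {f | (Function.support fun x => f x).Finite}
  mul_mem' := fun {f g} hf hg => by
    refine (hf.mul hg).subset fun x hx => ?_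
    by_contra hn
    refine hx ?_
    refine (mul_apply f g x).trans ?_
    refine (tsum_congr fun y => ?_).trans tsum_zero
    by_contra hy
    obtain ⟨h1, h2⟩ := mul_ne_zero_iff.1 hy
    exact hn ⟨y, h1, y⁻¹ * x, h2, by simp⟩
  add_mem' := fun {f g} hf hg => by
    refine (hf.union hg).subset ?_
    exact Function.support_add (fun x => f x) (fun x => g x)
  algebraMap_mem' := fun c => by
    refine (Set.finite_singleton (1 : G)).subset fun x hx => ?_
    by_contra hn
    refine hx ?_
    change (algebraMap ℂ (L1 G) c) x = 0
    rw [Algebra.algebraMap_eq_smul_one, smul_apply]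
    change c * single 1 x = 0
    rw [single_apply_ne hn, mul_zero]
  star_mem' := fun {f} hf => by
    refine hf.inv.subset fun x hx => ?_
    intro hn
    refine hx ?_
    change star (f x⁻¹) = 0
    rw [show f x⁻¹ = 0 from hn, star_zero]

end L1

/-! ### Matrix coefficients -/

section Regular

variable {G : Type*} [Group G] {X : Type*} [MulAction G X]

/-- The matrix coefficient `⟨λ(f) δ_{x'}, δ_x⟩ = ∑_{y • x' = x} f(y)`. -/
def entry (f : L1 G) (x x' : X) : ℂ := by
  classical exact ∑' y : G, if y • x' = x then f y else 0

theorem summable_entry [DecidableEq X] (f : L1 G) (x x' : X) :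
    Summable fun y : G => if y • x' = x then f y else 0 :=
  Summable.of_norm_bounded f.hasSum_norm.summable fun y => by
    split_ifs <;> simp

theorem hasSum_entry [DecidableEq X] (f : L1 G) (x x' : X) :
    HasSum (fun y : G => if y • x' = x then f y else 0) (entry f x x') := by
  have := (summable_entry f x x').hasSum
  unfold entry
  convert this

theorem entry_star (f : L1 G) (x x' : X) : entry (star f) x x' = star (entry f x' x) := by
  classical
  have h1 := (hasSum_entry f x' x).star
  have h2 := hasSum_entry (star f) x x'
  refine h2.unique ?_
  rw [← (Equiv.inv G).hasSum_iff] at h1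
  convert h1 using 2 with y
  simp only [Function.comp_apply, Equiv.inv_apply, L1.star_apply, inv_smul_eq_iff]
  by_cases h : y • x' = x
  · simp [h]
  · simp [h, Ne.symm h]

variable (p : ℝ≥0∞) [Fact (1 ≤ p)]

theorem hasSum_entry_mul (f : L1 G) (g : lp (fun _ : X => ℂ) p) (x : X) :
    HasSum (fun x' => g x' * entry f x x') (lam X p f g x) := by
  classical
  have h := hasSum_lam_apply p f g x
  let φ : G → X × G := fun y => (y⁻¹ • x, y)
  have hφ : Function.Injective φ := fun y z h => congrArg Prod.snd h
  let F : X × G → ℂ := fun q => g q.1 * (if q.2 • q.1 = x then f q.2 else 0)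
  have hF : HasSum F (lam X p f g x) := by
    refine (hφ.hasSum_iff ?_).1 ?_
    · rintro ⟨x', y⟩ hq
      have : ¬ y • x' = x := fun h => hq ⟨y, by simp [φ, ← h]⟩
      simp [F, this]
    · convert h using 2 with y
      simp [F, φ, mul_comm]
  exact hF.prod_fiberwise fun x' => (hasSum_entry f x x').mul_left (g x')

theorem lam_single_apply [DecidableEq X] (f : L1 G) (x x' : X) :
    lam X p f (lp.single p x' 1) x = entry f x x' := by
  refine (hasSum_entry_mul p f (lp.single p x' 1) x).unique ?_
  have := hasSum_single (f := fun z => lp.single (E := fun _ : X => ℂ) p x' 1 z * entry f x z) x'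
    (fun z hz => by rw [lp.single_apply_ne _ _ _ hz, zero_mul])
  simpa only [lp.single_apply_self, one_mul] using this

theorem lam_eq_zero_iff (f : L1 G) : lam X p f = 0 ↔ ∀ x x' : X, entry f x x' = 0 := by
  classical
  constructor
  · intro h x x'
    rw [← lam_single_apply p, h]; rfl
  · intro h
    ext g x
    refine (hasSum_entry_mul p f g x).unique ?_
    simp only [h, mul_zero]
    exact hasSum_zero

theorem hasSum_norm_entry (f : L1 G) (x' : X) :
    ∃ s, s ≤ ‖lam X 1 f‖ ∧ HasSum (fun x => ‖entry f x x'‖) s := by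
  classical
  refine ⟨‖lam X 1 f (lp.single 1 x' 1)‖, ?_, ?_⟩
  · refine (ContinuousLinearMap.le_opNorm _ _).trans ?_
    rw [lp.norm_single (by simp)]
    simp
  · have := lp.hasSum_norm (p := 1) (by simp) (lam X 1 f (lp.single 1 x' 1))
    simpa [lam_single_apply] using this

theorem norm_lam_top_star_le (f : L1 G) : ‖lam X ∞ (star f)‖ ≤ ‖lam X 1 f‖ := by
  refine ContinuousLinearMap.opNorm_le_bound _ (norm_nonneg _) fun g => ?_
  refine lp.norm_le_of_forall_le (by positivity) fun x => ?_
  obtain ⟨s, hs, hsum⟩ := hasSum_norm_entry f x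
  have h := hasSum_entry_mul ∞ (star f) g x
  rw [← h.tsum_eq]
  refine (tsum_of_norm_bounded (hsum.mul_right ‖g‖) fun x' => ?_).trans
    (mul_le_mul_of_nonneg_right hs (norm_nonneg _))
  rw [entry_star, norm_mul, norm_star, mul_comm]
  exact mul_le_mul_of_nonneg_left (lp.norm_apply_le_norm (by simp) g x') (norm_nonneg _)

theorem sum_norm_entry_le (f : L1 G) (x : X) (s : Finset X) :
    ∑ x' ∈ s, ‖entry f x x'‖ ≤ ‖lam X ∞ f‖ := by
  classical
  let u : X → ℂ := fun x' =>
    if x' ∈ s then star (entry f x x') / (‖entry f x x'‖ : ℂ) else 0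
  have hu : ∀ x', ‖u x'‖ ≤ 1 := fun x' => by
    by_cases h : x' ∈ s
    · simp only [u, if_pos h, norm_div, norm_star, Complex.norm_real, norm_norm]
      exact div_self_le_one _
    · simp [u, h]
  have hmul : ∀ x', u x' * entry f x x' = if x' ∈ s then (‖entry f x x'‖ : ℂ) else 0 := fun x' => by
    by_cases h : x' ∈ s
    · simp only [u, if_pos h]
      by_cases h0 : entry f x x' = 0
      · simp [h0]
      · have h1 : (‖entry f x x'‖ : ℂ) ≠ 0 := by simpa using h0
        have h2 : star (entry f x x') * entry f x x' = (‖entry f x x'‖ : ℂ) ^ 2 :=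
          Complex.conj_mul' _
        rw [div_mul_eq_mul_div, h2, pow_two, mul_div_assoc, div_self h1, mul_one]
    · simp [u, h]
  let g : lp (fun _ : X => ℂ) ∞ :=
    ⟨u, memℓp_infty ⟨1, by rintro _ ⟨x', rfl⟩; exact hu x'⟩⟩
  have hg : ‖g‖ ≤ 1 := lp.norm_le_of_forall_le zero_le_one hu
  have h := hasSum_entry_mul ∞ f g x
  have h' : HasSum (fun x' => g x' * entry f x x') (∑ x' ∈ s, (‖entry f x x'‖ : ℂ)) := by
    have := hasSum_sum_of_ne_finset_zero (f := fun x' => g x' * entry f x x') (s := s)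
      (fun x' hx' => (hmul x').trans (if_neg hx')) (L := SummationFilter.unconditional X)
    convert this using 1
    refine Finset.sum_congr rfl fun x' hx' => ?_
    exact ((hmul x').trans (if_pos hx')).symm
  have h3 := h.unique h'
  calc ∑ x' ∈ s, ‖entry f x x'‖ = ‖lam X ∞ f g x‖ := by
        rw [h3, ← Complex.ofReal_sum, Complex.norm_real, Real.norm_of_nonneg]
        exact Finset.sum_nonneg fun _ _ => norm_nonneg _
    _ ≤ ‖lam X ∞ f g‖ := lp.norm_apply_le_norm (by simp) _ x
    _ ≤ ‖lam X ∞ f‖ * ‖g‖ := ContinuousLinearMap.le_opNorm _ _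
    _ ≤ ‖lam X ∞ f‖ := mul_le_of_le_one_right (norm_nonneg _) hg

theorem norm_lam_one_star_le (f : L1 G) : ‖lam X 1 (star f)‖ ≤ ‖lam X ∞ f‖ := by
  classical
  refine ContinuousLinearMap.opNorm_le_bound _ (norm_nonneg _) fun g => ?_
  have hδ : ∀ x' : X, ‖lam X 1 (star f) (lp.single 1 x' 1)‖ ≤ ‖lam X ∞ f‖ := fun x' => by
    refine lp.norm_le_of_forall_sum_le (by simp) (norm_nonneg _) fun s => ?_
    simpa [lam_single_apply, entry_star] using sum_norm_entry_le f x' s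
  have hg := (lp.hasSum_single (p := 1) (by simp) g).mapL (lam X 1 (star f))
  have hn : HasSum (fun x => ‖g x‖) ‖g‖ := by
    simpa using lp.hasSum_norm (p := 1) (by simp) g
  rw [← hg.tsum_eq, mul_comm]
  refine tsum_of_norm_bounded (hn.mul_right _) fun x' => ?_
  have : lp.single (E := fun _ : X => ℂ) 1 x' (g x') = g x' • lp.single 1 x' (1 : ℂ) := by
    rw [← lp.single_smul]; simp
  rw [this, map_smul, norm_smul]
  exact mul_le_mul_of_nonneg_left (hδ x') (norm_nonneg _)

/-- The regular representation as an algebra homomorphism. -/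
def lamHom (X : Type*) [MulAction G X] (p : ℝ≥0∞) [Fact (1 ≤ p)] :
    L1 G →ₐ[ℂ] (lp (fun _ : X => ℂ) p →L[ℂ] lp (fun _ : X => ℂ) p) :=
  { toFun := lam X p
    map_one' := lam_one p
    map_mul' := lam_mul p
    map_zero' := map_zero (lam X p)
    map_add' := map_add (lam X p)
    commutes' := fun c => by
      rw [Algebra.algebraMap_eq_smul_one, map_smul, lam_one, Algebra.algebraMap_eq_smul_one]
      rfl }

theorem lamHom_apply (f : L1 G) : lamHom X p f = lam X p f := rfl

end Regular

/-! ### The `*`-algebra `ℓ¹(G:H)` and its completion `PF*₁(G:H)` -/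

variable {G : Type*} [Group G]

/-- `Ker`, the kernel of the representation of `ℓ¹(G)` on `ℓ²(G/H)`. -/
def kernel (H : Subgroup G) : Ideal (L1 G) := RingHom.ker (lamHom (G ⧸ H) 2)

instance (H : Subgroup G) : (kernel H).IsTwoSided :=
  inferInstanceAs (RingHom.ker (lamHom (G ⧸ H) 2)).IsTwoSided

theorem mem_kernel_iff (H : Subgroup G) (p : ℝ≥0∞) [Fact (1 ≤ p)] (f : L1 G) :
    f ∈ kernel H ↔ lamHom (G ⧸ H) p f = 0 := by
  rw [kernel, RingHom.mem_ker, lamHom_apply, lamHom_apply, lam_eq_zero_iff, lam_eq_zero_iff]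

theorem star_mem_kernel (H : Subgroup G) {f : L1 G} (hf : f ∈ kernel H) : star f ∈ kernel H := by
  rw [mem_kernel_iff H 2, lamHom_apply, lam_eq_zero_iff] at hf ⊢
  intro x x'
  rw [entry_star, hf, star_zero]

/-- `ℓ¹(G:H) = ℓ¹(G) / Ker`. -/
def L1Pair (H : Subgroup G) : Type _ := L1 G ⧸ kernel H

namespace L1Pair

variable (H : Subgroup G)

instance : Ring (L1Pair H) := inferInstanceAs (Ring (L1 G ⧸ kernel H))
instance : Algebra ℂ (L1Pair H) := inferInstanceAs (Algebra ℂ (L1 G ⧸ kernel H))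

/-- The class `[f]` of `f ∈ ℓ¹(G)`. -/
def mk : L1 G →ₐ[ℂ] L1Pair H := Ideal.Quotient.mkₐ ℂ (kernel H)

theorem mk_surjective : Function.Surjective (mk H) := Ideal.Quotient.mkₐ_surjective ℂ (kernel H)

theorem mk_eq_mk_iff (f g : L1 G) : mk H f = mk H g ↔ f - g ∈ kernel H := Ideal.Quotient.eq

/-- The involution `[f]* = [f*]`. -/
instance : Star (L1Pair H) :=
  ⟨Quotient.lift (fun f : L1 G => mk H (star f)) (fun f g h => by
    rw [mk_eq_mk_iff, ← star_sub]
    exact star_mem_kernel H ((mk_eq_mk_iff H f g).1 (Quotient.sound h)))⟩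

theorem star_mk (f : L1 G) : star (mk H f) = mk H (star f) := rfl

instance : StarRing (L1Pair H) where
  star_involutive a := by
    obtain ⟨f, rfl⟩ := mk_surjective H a
    rw [star_mk, star_mk, star_star]
  star_add a b := by
    obtain ⟨f, rfl⟩ := mk_surjective H a
    obtain ⟨g, rfl⟩ := mk_surjective H b
    rw [← map_add, star_mk, star_mk, star_mk, star_add, map_add]
  star_mul a b := by
    obtain ⟨f, rfl⟩ := mk_surjective H a
    obtain ⟨g, rfl⟩ := mk_surjective H b
    rw [← map_mul, star_mk, star_mk, star_mk, star_mul, map_mul]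

instance : StarModule ℂ (L1Pair H) where
  star_smul c a := by
    obtain ⟨f, rfl⟩ := mk_surjective H a
    rw [← map_smul, star_mk, star_mk, star_smul, map_smul]

/-- The quotient map `f ↦ [f]` as a `*`-homomorphism. -/
def mkStar : L1 G →⋆ₐ[ℂ] L1Pair H :=
  { mk H with map_star' := fun f => (star_mk H f).symm }

/-- The faithful representation of `ℓ¹(G:H)` on `ℓ^p(G/H)`. -/
def lamHom (p : ℝ≥0∞) [Fact (1 ≤ p)] :
    L1Pair H →ₐ[ℂ] (lp (fun _ : G ⧸ H => ℂ) p →L[ℂ] lp (fun _ : G ⧸ H => ℂ) p) :=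
  Ideal.Quotient.liftₐ (kernel H) (GroupPair.lamHom (G ⧸ H) p)
    (fun f hf => (mem_kernel_iff H p f).1 hf)

theorem lamHom_mk (p : ℝ≥0∞) [Fact (1 ≤ p)] (f : L1 G) :
    lamHom H p (mk H f) = lam (G ⧸ H) p f := rfl

theorem lamHom_injective (p : ℝ≥0∞) [Fact (1 ≤ p)] : Function.Injective (lamHom H p) := by
  refine (injective_iff_map_eq_zero _).2 fun a ha => ?_
  obtain ⟨f, rfl⟩ := mk_surjective H a
  rw [← map_zero (mk H), mk_eq_mk_iff, sub_zero]
  exact (mem_kernel_iff H p f).2 ha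

/-- The pair of representations on `ℓ¹(G/H)` and `ℓ^∞(G/H)`. -/
def lamPair : L1Pair H →ₐ[ℂ]
    (lp (fun _ : G ⧸ H => ℂ) 1 →L[ℂ] lp (fun _ : G ⧸ H => ℂ) 1) ×
      (lp (fun _ : G ⧸ H => ℂ) ∞ →L[ℂ] lp (fun _ : G ⧸ H => ℂ) ∞) :=
  (lamHom H 1).prod (lamHom H ∞)

theorem lamPair_injective : Function.Injective (lamPair H) := fun _ _ h =>
  lamHom_injective H 1 (congrArg Prod.fst h)

/-- `ℓ¹(G:H)` with the `PF*₁`-norm, the maximum of the operator norms on `ℓ¹(G/H)` and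
`ℓ^∞(G/H)`. -/
instance : NormedRing (L1Pair H) :=
  NormedRing.induced (L1Pair H) _ (lamPair H) (lamPair_injective H)

instance : NormedAlgebra ℂ (L1Pair H) :=
  NormedAlgebra.induced ℂ (L1Pair H) _ (lamPair H)

theorem norm_mk (f : L1 G) :
    ‖mk H f‖ = max ‖lam (G ⧸ H) 1 f‖ ‖lam (G ⧸ H) ∞ f‖ := rfl

instance : NormedStarGroup (L1Pair H) where
  norm_star_le a := by
    obtain ⟨f, rfl⟩ := mk_surjective H a
    rw [star_mk, norm_mk, norm_mk]
    exact max_le ((norm_lam_one_star_le f).trans (le_max_right _ _))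
      ((norm_lam_top_star_le f).trans (le_max_left _ _))

end L1Pair

/-- `PF*₁(G:H)`, the completion of `ℓ¹(G:H)` in the `PF*₁`-norm. -/
def PF1 (H : Subgroup G) : Type _ := UniformSpace.Completion (L1Pair H)

namespace PF1

variable (H : Subgroup G)

instance : NormedRing (PF1 H) := inferInstanceAs (NormedRing (UniformSpace.Completion (L1Pair H)))

instance : CompleteSpace (PF1 H) :=
  inferInstanceAs (CompleteSpace (UniformSpace.Completion (L1Pair H)))

instance : NormedAlgebra ℂ (PF1 H) :=
  { (inferInstance : Algebra ℂ (UniformSpace.Completion (L1Pair H))) with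
    norm_smul_le := norm_smul_le (α := ℂ) (β := UniformSpace.Completion (L1Pair H)) }

/-- The canonical embedding `ℓ¹(G:H) → PF*₁(G:H)`. -/
def ofL1Pair : L1Pair H →ₐ[ℂ] PF1 H :=
  { (UniformSpace.Completion.coeRingHom : L1Pair H →+* UniformSpace.Completion (L1Pair H)) with
    commutes' := fun _ => rfl }

theorem norm_ofL1Pair (a : L1Pair H) : ‖ofL1Pair H a‖ = ‖a‖ := UniformSpace.Completion.norm_coe a

theorem denseRange_ofL1Pair : DenseRange (ofL1Pair H) :=
  UniformSpace.Completion.denseRange_coe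

/-- The continuous extension of the involution of `ℓ¹(G:H)`. -/
instance : Star (PF1 H) := ⟨UniformSpace.Completion.map (star : L1Pair H → L1Pair H)⟩

theorem continuous_star' : Continuous (star : PF1 H → PF1 H) :=
  UniformSpace.Completion.continuous_map

theorem star_ofL1Pair (a : L1Pair H) : star (ofL1Pair H a) = ofL1Pair H (star a) :=
  UniformSpace.Completion.map_coe (star_isometry (E := L1Pair H)).uniformContinuous a

instance : StarRing (PF1 H) where
  star_involutive a := by
    refine (denseRange_ofL1Pair H).induction_on (p := fun a => star (star a) = a) a ?_ ?_
    · exact isClosed_eq ((continuous_star' H).comp (continuous_star' H)) continuous_id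
    · intro a
      rw [star_ofL1Pair, star_ofL1Pair, star_star]
  star_add a b := by
    refine (denseRange_ofL1Pair H).induction_on₂
      (p := fun a b => star (a + b) = star a + star b) ?_ ?_ a b
    · exact isClosed_eq ((continuous_star' H).comp continuous_add)
        (((continuous_star' H).comp continuous_fst).add ((continuous_star' H).comp continuous_snd))
    · intro a b
      rw [← map_add, star_ofL1Pair, star_ofL1Pair, star_ofL1Pair, star_add, map_add]
  star_mul a b := by
    refine (denseRange_ofL1Pair H).induction_on₂
      (p := fun a b => star (a * b) = star b * star a) ?_ ?_ a b
    · exact isClosed_eq ((continuous_star' H).comp continuous_mul)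
        (((continuous_star' H).comp continuous_snd).mul ((continuous_star' H).comp continuous_fst))
    · intro a b
      rw [← map_mul, star_ofL1Pair, star_ofL1Pair, star_ofL1Pair, star_mul, map_mul]

instance : StarModule ℂ (PF1 H) where
  star_smul c a := by
    refine (denseRange_ofL1Pair H).induction_on
      (p := fun a => star (c • a) = star c • star a) a ?_ ?_
    · exact isClosed_eq ((continuous_star' H).comp (continuous_const_smul c))
        ((continuous_star' H).const_smul (star c))
    · intro a
      rw [← map_smul, star_ofL1Pair, star_ofL1Pair, star_smul, map_smul]

instance : NormedStarGroup (PF1 H) where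
  norm_star_le a := by
    refine (denseRange_ofL1Pair H).induction_on (p := fun a => ‖star a‖ ≤ ‖a‖) a ?_ ?_
    · exact isClosed_le (continuous_star' H).norm continuous_norm
    · intro a
      rw [star_ofL1Pair, norm_ofL1Pair, norm_ofL1Pair, norm_star]

/-- The embedding `ℓ¹(G:H) → PF*₁(G:H)` as a `*`-homomorphism. -/
def ofL1PairStar : L1Pair H →⋆ₐ[ℂ] PF1 H :=
  { ofL1Pair H with map_star' := fun a => (star_ofL1Pair H a).symm }

/-- The `*`-subalgebra `[ℂG] = {[f] : f ∈ ℂG}` of `PF*₁(G:H)`. -/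
def groupAlgebraClasses : StarSubalgebra ℂ (PF1 H) :=
  (L1.groupAlgebra G).map ((ofL1PairStar H).comp (L1Pair.mkStar H))

end PF1

/-- A `*`-subalgebra `S` of `A` is quasi-Hermitian in `A` if every self-adjoint element of `S`
has real spectrum in `A`. -/
def IsQuasiHermitianIn {A : Type*} [Ring A] [Algebra ℂ A] [StarRing A] [StarModule ℂ A]
    (S : StarSubalgebra ℂ A) : Prop :=
  ∀ a ∈ S, IsSelfAdjoint a → ∀ z ∈ spectrum ℂ a, z.im = 0

/-- The pair `(G, H)` is quasi-Hermitian if `[ℂG]` is quasi-Hermitian in `PF*₁(G:H)`. -/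
def IsQuasiHermitianPair (H : Subgroup G) : Prop :=
  IsQuasiHermitianIn (PF1.groupAlgebraClasses H)

/-- `H` is co-amenable in `G` if there is a mean (a positive unital functional) on `ℓ^∞(G/H)`
that is invariant under left translation by `G`. -/
def IsCoamenable (H : Subgroup G) : Prop :=
  ∃ m : lp (fun _ : G ⧸ H => ℂ) ∞ →L[ℂ] ℂ,
    m 1 = 1 ∧
    (∀ φ : lp (fun _ : G ⧸ H => ℂ) ∞, (∀ x, 0 ≤ φ x) → 0 ≤ m φ) ∧
    ∀ (y : G) (φ : lp (fun _ : G ⧸ H => ℂ) ∞), m (translate ∞ y φ) = m φ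

end GroupPair

end

open scoped ENNReal ComplexOrder

noncomputable section

namespace GroupPair

/-! Suppose that `H` is not co-amenable. A Kesten-type argument (`exists_norm_lam_average_lt_one`)
gives a finite symmetric set `F ∋ 1` whose uniform average `x` has norm `ρ < 1` on `ℓ²(G/H)`. Its
spectrum there is real and lies in `[-ρ, ρ]`; by the quasi-Hermitian hypothesis its spectrum in `PF1
H` is real too, and lies in `[-1, 1]`.

For `0 < θ < 1` consider `M a = ‖a‖₁ ^ (1 - θ) * ‖a‖₂ ^ θ`, with `‖·‖₁` the norm of `PF1 H` and
`‖·‖₂` the operator norm on `ℓ²(G/H)`. It is submultiplicative but in general not subadditive, so it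
is replaced by its hull, the infimum of `∑ M aᵢ` over decompositions, which is a ring seminorm. A
spectral value `s` of `x` for the hull satisfies `|q(s)| ≤ r₁ ^ (1 - θ) * r₂ ^ θ` for every
polynomial `q`, with `r₁`, `r₂` the suprema of `|q|` on the two spectra. Since both spectra are
real, a quadratic `q` with its peak at `Re s` first forces `s` to be real and then forces `|s| ≤ ρ`
(`false_of_interpolation`).

On the other hand, the powers of `x` cannot decay fast in the hull: `xⁿ` pushes a base point to a
probability measure on at most `|F|ⁿ` points, and Cauchy–Schwarz gives the lower bound `|F| ^ (-θ n
/ 2)` (`pow_le_sum_interpolated`). So `|s| ≥ |F| ^ (-θ / 2)` for some `s`, and this exceeds `ρ` once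
`θ` is small: a contradiction. -/

/-! ### The largest seminorm below a submultiplicative function -/

section SeminormHull

variable {A : Type*} [Ring A]

/-- The infimum of `∑ M (aᵢ)` over all finite decompositions `a = ∑ aᵢ`. -/
def seminormHull (M : A → ℝ) (a : A) : ℝ :=
  sInf {t | ∃ l : List A, l.sum = a ∧ (l.map M).sum = t}

variable {M : A → ℝ}

theorem le_seminormHull {a : A} {c : ℝ} (h : ∀ l : List A, l.sum = a → c ≤ (l.map M).sum) :
    c ≤ seminormHull M a := by
  refine le_csInf ⟨M a, [a], by simp, by simp⟩ ?_
  rintro _ ⟨l, hl, rfl⟩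
  exact h l hl

theorem seminormHull_sum_le (hM : ∀ a, 0 ≤ M a) (l : List A) :
    seminormHull M l.sum ≤ (l.map M).sum := by
  refine csInf_le ⟨0, ?_⟩ ⟨l, rfl, rfl⟩
  rintro _ ⟨l, -, rfl⟩
  exact List.sum_nonneg (by simpa using fun a _ => hM a)

theorem seminormHull_le (hM : ∀ a, 0 ≤ M a) (a : A) : seminormHull M a ≤ M a := by
  simpa using seminormHull_sum_le hM [a]

theorem seminormHull_nonneg (hM : ∀ a, 0 ≤ M a) (a : A) : 0 ≤ seminormHull M a :=
  le_seminormHull fun _ _ => List.sum_nonneg (by simpa using fun a _ => hM a)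

theorem exists_decomposition_lt {a : A} {t : ℝ} (ht : seminormHull M a < t) :
    ∃ l : List A, l.sum = a ∧ (l.map M).sum < t := by
  obtain ⟨_, ⟨l, hl, rfl⟩, h⟩ := exists_lt_of_csInf_lt (s := {t | ∃ l : List A, l.sum = a ∧ (l.map M).sum = t})
    ⟨M a, [a], by simp, by simp⟩ ht
  exact ⟨l, hl, h⟩

theorem seminormHull_add_le (hM : ∀ a, 0 ≤ M a) (a b : A) :
    seminormHull M (a + b) ≤ seminormHull M a + seminormHull M b := by
  refine le_of_forall_pos_lt_add fun ε hε => ?_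
  obtain ⟨l, rfl, hl⟩ := exists_decomposition_lt (lt_add_of_pos_right (seminormHull M a) (half_pos hε))
  obtain ⟨k, rfl, hk⟩ := exists_decomposition_lt (lt_add_of_pos_right (seminormHull M b) (half_pos hε))
  have h := seminormHull_sum_le hM (l ++ k)
  rw [List.sum_append, List.map_append, List.sum_append] at h
  linarith

/-- Expanding the product, the elements `aᵢ * bⱼ` decompose `l.sum * k.sum`, and submultiplicativity
of `M` bounds their total cost by the product of the two costs. -/
theorem seminormHull_mul_le_sum (hM : ∀ a, 0 ≤ M a) (hmul : ∀ a b, M (a * b) ≤ M a * M b)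
    (l k : List A) :
    seminormHull M (l.sum * k.sum) ≤ (l.map M).sum * (k.map M).sum := by
  induction l with
  | nil => simpa using seminormHull_sum_le hM []
  | cons a l ih =>
    rw [List.sum_cons, List.map_cons, List.sum_cons, add_mul, add_mul]
    refine (seminormHull_add_le hM _ _).trans (add_le_add ?_ ih)
    have hk : a * k.sum = (k.map fun b => a * b).sum := by
      simpa using (List.sum_map_mul_left (l := k) (f := id) (r := a)).symm
    rw [hk]
    refine (seminormHull_sum_le hM _).trans ?_
    rw [← List.sum_map_mul_left, List.map_map]
    exact List.sum_le_sum fun b _ => hmul a b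

theorem seminormHull_mul_le (hM : ∀ a, 0 ≤ M a) (hmul : ∀ a b, M (a * b) ≤ M a * M b) (a b : A) :
    seminormHull M (a * b) ≤ seminormHull M a * seminormHull M b := by
  have hlim : Filter.Tendsto (fun ε : ℝ => (seminormHull M a + ε) * (seminormHull M b + ε))
      (nhdsWithin 0 (Set.Ioi 0)) (nhds (seminormHull M a * seminormHull M b)) := by
    have : Continuous fun ε : ℝ => (seminormHull M a + ε) * (seminormHull M b + ε) := by fun_prop
    simpa using (this.tendsto 0).mono_left nhdsWithin_le_nhds
  refine ge_of_tendsto hlim ?_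
  filter_upwards [self_mem_nhdsWithin] with ε hε
  obtain ⟨l, hla, hl⟩ := exists_decomposition_lt (lt_add_of_pos_right (seminormHull M a) hε)
  obtain ⟨k, hkb, hk⟩ := exists_decomposition_lt (lt_add_of_pos_right (seminormHull M b) hε)
  have h := seminormHull_mul_le_sum hM hmul l k
  rw [hla, hkb] at h
  have hk0 : 0 ≤ (k.map M).sum := List.sum_nonneg (by simpa using fun a _ => hM a)
  exact h.trans (mul_le_mul hl.le hk.le hk0
    (add_nonneg (seminormHull_nonneg hM a) (le_of_lt hε)))

theorem seminormHull_smul_le [Algebra ℂ A] (hM : ∀ a, 0 ≤ M a)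
    (hsmul : ∀ (c : ℂ) a, M (c • a) ≤ ‖c‖ * M a) (c : ℂ) (a : A) :
    seminormHull M (c • a) ≤ ‖c‖ * seminormHull M a := by
  refine le_of_forall_pos_lt_add fun ε hε => ?_
  -- The added `1` keeps the tolerance `ε / (‖c‖ + 1)` meaningful when `c = 0`.
  have hc : 0 < ‖c‖ + 1 := by positivity
  obtain ⟨l, rfl, hl⟩ := exists_decomposition_lt
    (lt_add_of_pos_right (seminormHull M a) (div_pos hε hc))
  rw [List.smul_sum]
  refine (seminormHull_sum_le hM _).trans_lt ?_
  rw [List.map_map]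
  have h1 : (l.map (M ∘ fun x => c • x)).sum ≤ ‖c‖ * (l.map M).sum := by
    rw [← List.sum_map_mul_left]
    exact List.sum_le_sum fun b _ => hsmul c b
  have h2 : ‖c‖ * (ε / (‖c‖ + 1)) < ε := by
    rw [mul_div_assoc', div_lt_iff₀ hc]
    nlinarith
  have h3 := mul_le_mul_of_nonneg_left hl.le (norm_nonneg c)
  rw [mul_add] at h3
  linarith

/-- The hull of a submultiplicative homogeneous function is a ring seminorm. -/
def ringSeminormHull [Algebra ℂ A] (M : A → ℝ) (hM : ∀ a, 0 ≤ M a)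
    (hmul : ∀ a b, M (a * b) ≤ M a * M b) (hsmul : ∀ (c : ℂ) a, M (c • a) ≤ ‖c‖ * M a) :
    RingSeminorm A where
  toFun := seminormHull M
  map_zero' := le_antisymm (by simpa using seminormHull_sum_le hM []) (seminormHull_nonneg hM 0)
  add_le' := seminormHull_add_le hM
  neg' a := by
    have h : ∀ a, seminormHull M (-a) ≤ seminormHull M a := fun a => by
      simpa using seminormHull_smul_le hM hsmul (-1) a
    exact le_antisymm (h a) (by simpa using h (-a))
  mul_le' := seminormHull_mul_le hM hmul

end SeminormHull

/-! ### Spectral radius estimates -/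

section Spectral

open Polynomial

/-- Gelfand's formula gives `‖aⁿ‖ ≤ κⁿ` only for large `n`; the constant absorbs the finitely many
remaining powers. -/
theorem norm_pow_le_of_spectrum {R : Type*} [NormedRing R] [NormedAlgebra ℂ R] [CompleteSpace R]
    (a : R) {r κ : ℝ} (hκ : r < κ) (h0 : 0 ≤ r) (h : ∀ z ∈ spectrum ℂ a, ‖z‖ ≤ r) :
    ∃ C, 0 ≤ C ∧ ∀ n : ℕ, ‖a ^ n‖ ≤ C * κ ^ n := by
  have hr : spectralRadius ℂ a < ENNReal.ofReal κ := by
    refine lt_of_le_of_lt (iSup₂_le fun z hz => ?_) ((ENNReal.ofReal_lt_ofReal_iff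
      (h0.trans_lt hκ)).2 hκ)
    rw [← ENNReal.ofReal_coe_nnreal]
    exact ENNReal.ofReal_le_ofReal (h z hz)
  have hev := (spectrum.pow_norm_pow_one_div_tendsto_nhds_spectralRadius a).eventually_lt_const hr
  obtain ⟨N, hN⟩ := Filter.eventually_atTop.1 hev
  have hκ0 : 0 < κ := h0.trans_lt hκ
  refine ⟨1 + ∑ n ∈ Finset.range (N + 1), ‖a ^ n‖ / κ ^ n, by positivity, fun n => ?_⟩
  rcases lt_or_ge n (N + 1) with hn | hn
  · rw [← div_le_iff₀ (by positivity)]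
    have := Finset.single_le_sum (f := fun n => ‖a ^ n‖ / κ ^ n)
      (fun i _ => by positivity) (Finset.mem_range.2 hn)
    linarith
  · have h1 := (ENNReal.ofReal_lt_ofReal_iff hκ0).1 (hN n (by omega))
    have h2 : ‖a ^ n‖ ≤ κ ^ n := by
      have h3 := pow_le_pow_left₀ (by positivity) h1.le n
      rwa [one_div, Real.rpow_inv_natCast_pow (norm_nonneg _) (by omega)] at h3
    refine h2.trans (le_mul_of_one_le_left (by positivity) ?_)
    exact le_add_of_nonneg_right (by positivity)

/-- Since `zⁿ` lies in the spectrum of `aⁿ`, `‖z‖ⁿ` is at most `‖aⁿ‖ * ‖1‖`; the factor `‖1‖` is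
harmless as `n → ∞`. -/
theorem norm_le_of_mem_spectrum_of_pow_le {R : Type*} [NormedRing R] [NormedAlgebra ℂ R]
    [CompleteSpace R] {a : R} {z : ℂ} (hz : z ∈ spectrum ℂ a) {C r : ℝ} (hr : 0 ≤ r)
    (h : ∀ n : ℕ, ‖a ^ n‖ ≤ C * r ^ n) : ‖z‖ ≤ r := by
  by_contra! hlt
  have hz0 : 0 < ‖z‖ := hr.trans_lt hlt
  have hzn : ∀ n : ℕ, ‖z‖ ^ n ≤ C * ‖(1 : R)‖ * r ^ n := fun n => by
    have h1 := spectrum.norm_le_norm_mul_of_mem (spectrum.pow_mem_pow a n hz)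
    rw [norm_pow] at h1
    calc _ ≤ _ := h1
      _ ≤ C * r ^ n * ‖(1 : R)‖ := mul_le_mul_of_nonneg_right (h n) (norm_nonneg _)
      _ = _ := by ring
  have hlim : Filter.Tendsto (fun n : ℕ => C * ‖(1 : R)‖ * (r / ‖z‖) ^ n) Filter.atTop (nhds 0) := by
    simpa using (tendsto_pow_atTop_nhds_zero_of_lt_one (by positivity)
      ((div_lt_one hz0).2 hlt)).const_mul (C * ‖(1 : R)‖)
  obtain ⟨n, hn⟩ := (hlim.eventually_lt_const one_pos).exists
  have := hzn n
  rw [div_pow, mul_div_assoc', div_lt_one (by positivity)] at hn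
  linarith

/-- An element of a seminormed algebra has a spectral value, of modulus the spectral radius, at
which the polynomials are bounded by their spectral radii. -/
theorem exists_spectral_value {A : Type*} [Ring A] [Algebra ℂ A] (N : RingSeminorm A)
    (hsmul : ∀ (c : ℂ) a, N (c • a) ≤ ‖c‖ * N a) (x : A) {c : ℝ} (hc : 0 < c)
    (hx : ∀ n : ℕ, c ^ n ≤ N (x ^ n)) :
    ∃ s : ℂ, c ≤ ‖s‖ ∧ ∀ (q : ℂ[X]) (C r : ℝ), 0 ≤ r →
      (∀ n : ℕ, N (aeval x q ^ n) ≤ C * r ^ n) → ‖q.eval s‖ ≤ r := by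
  let := N.toSeminormedRing
  have hN : ∀ a : A, ‖a‖ = N a := fun _ => rfl
  let : NormedAlgebra ℂ A := { (inferInstance : Algebra ℂ A) with norm_smul_le := hsmul }
  let B := UniformSpace.Completion A
  let : NormedAlgebra ℂ B :=
    { (inferInstance : Algebra ℂ (UniformSpace.Completion A)) with
      norm_smul_le := norm_smul_le (α := ℂ) (β := UniformSpace.Completion A) }
  let ι : A →ₐ[ℂ] B :=
    { (UniformSpace.Completion.coeRingHom : A →+* UniformSpace.Completion A) with
      commutes' := fun _ => rfl }
  have hι : ∀ a, ‖ι a‖ = N a := fun a => UniformSpace.Completion.norm_coe a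
  -- The case `n = 0` of `hx` reads `1 ≤ N 1`, so the completion is nontrivial and its spectra are
  -- nonempty.
  have h1 : (1 : B) ≠ 0 := fun h => by
    have h2 := hx 0
    rw [pow_zero, pow_zero, ← hι, map_one, h, norm_zero] at h2
    linarith
  have : Nontrivial B := ⟨1, 0, h1⟩
  obtain ⟨s, hs, hsr⟩ := spectrum.exists_nnnorm_eq_spectralRadius (ι x)
  refine ⟨s, ?_, fun q C r hr hq => ?_⟩
  -- If the spectral radius were below `c`, the powers of `x` would be `O(κⁿ)` with `κ < c`, against
  -- `hx`.
  · by_contra! hlt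
    obtain ⟨κ, hκ1, hκ2⟩ := exists_between hlt
    obtain ⟨C, -, hC⟩ := norm_pow_le_of_spectrum (ι x) hκ1 (norm_nonneg s) fun z hz => by
      have : (‖z‖₊ : ℝ≥0∞) ≤ ‖s‖₊ := hsr ▸ le_iSup₂ (f := fun k (_ : k ∈ spectrum ℂ (ι x)) =>
        (‖k‖₊ : ℝ≥0∞)) z hz
      exact_mod_cast this
    have hκ0 : 0 < κ := (norm_nonneg s).trans_lt hκ1
    have hlim : Filter.Tendsto (fun n : ℕ => C * (κ / c) ^ n) Filter.atTop (nhds 0) := by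
      simpa using (tendsto_pow_atTop_nhds_zero_of_lt_one (by positivity)
        ((div_lt_one hc).2 hκ2)).const_mul C
    obtain ⟨n, hn⟩ := (hlim.eventually_lt_const one_pos).exists
    rw [div_pow, mul_div_assoc', div_lt_one (by positivity)] at hn
    have h3 := hC n
    rw [← map_pow, hι] at h3
    linarith [hx n]
  · have h2 : q.eval s ∈ spectrum ℂ (aeval (ι x) q) :=
      spectrum.subset_polynomial_aeval (ι x) q ⟨s, hs, rfl⟩
    refine norm_le_of_mem_spectrum_of_pow_le h2 hr (C := C) fun n => ?_
    rw [aeval_algHom_apply, ← map_pow, hι]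
    exact hq n

theorem norm_aeval_pow_le {R : Type*} [NormedRing R] [NormedAlgebra ℂ R] [CompleteSpace R]
    (a : R) (q : ℂ[X]) {r κ : ℝ} (hκ : r < κ) (h0 : 0 ≤ r)
    (h : ∀ z ∈ spectrum ℂ a, ‖q.eval z‖ ≤ r) :
    ∃ C, 0 ≤ C ∧ ∀ n : ℕ, ‖aeval a q ^ n‖ ≤ C * κ ^ n := by
  rcases subsingleton_or_nontrivial R with hR | hR
  · exact ⟨0, le_rfl, fun n => by simp [Subsingleton.elim (aeval a q ^ n) 0]⟩
  · refine norm_pow_le_of_spectrum _ hκ h0 fun z hz => ?_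
    rw [spectrum.map_polynomial_aeval] at hz
    obtain ⟨w, hw, rfl⟩ := hz
    exact h w hw

/-- The interpolation argument: a real spectrum for `N₁` confines the spectrum for the
interpolated seminorm to the spectrum for `N₂`. -/
theorem false_of_interpolation {A : Type*} [Ring A] [Algebra ℂ A] {R₁ R₂ : Type*}
    [NormedRing R₁] [NormedAlgebra ℂ R₁] [CompleteSpace R₁]
    [NormedRing R₂] [NormedAlgebra ℂ R₂] [CompleteSpace R₂]
    (π₁ : A →ₐ[ℂ] R₁) (π₂ : A →ₐ[ℂ] R₂) (x : A) {θ ρ c : ℝ} (hθ : 0 < θ) (hθ1 : θ < 1)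
    (h₁ : ∀ z ∈ spectrum ℂ (π₁ x), z.im = 0) (h₂ : ∀ z ∈ spectrum ℂ (π₂ x), z.im = 0)
    (hn₁ : ∀ n : ℕ, ‖π₁ x ^ n‖ ≤ 1) (hn₂ : ∀ n : ℕ, ‖π₂ x ^ n‖ ≤ ρ ^ n)
    (hρ : 0 ≤ ρ) (hc : ρ < c) (hc1 : c ≤ 1)
    (hlow : ∀ (n : ℕ) (l : List A), l.sum = x ^ n →
      c ^ n ≤ (l.map fun a => ‖π₁ a‖ ^ (1 - θ) * ‖π₂ a‖ ^ θ).sum) : False := by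
  have hθ' : 0 < 1 - θ := by linarith
  have hc0 : 0 < c := hρ.trans_lt hc
  let M : A → ℝ := fun a => ‖π₁ a‖ ^ (1 - θ) * ‖π₂ a‖ ^ θ
  have hM : ∀ a, 0 ≤ M a := fun a => by positivity
  have hmul : ∀ a b, M (a * b) ≤ M a * M b := fun a b => by
    have e1 : ‖π₁ (a * b)‖ ^ (1 - θ) ≤ (‖π₁ a‖ * ‖π₁ b‖) ^ (1 - θ) :=
      Real.rpow_le_rpow (norm_nonneg _) (by rw [map_mul]; exact norm_mul_le _ _) hθ'.le
    have e2 : ‖π₂ (a * b)‖ ^ θ ≤ (‖π₂ a‖ * ‖π₂ b‖) ^ θ :=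
      Real.rpow_le_rpow (norm_nonneg _) (by rw [map_mul]; exact norm_mul_le _ _) hθ.le
    refine (mul_le_mul e1 e2 (by positivity) (by positivity)).trans_eq ?_
    rw [Real.mul_rpow (norm_nonneg _) (norm_nonneg _), Real.mul_rpow (norm_nonneg _) (norm_nonneg _)]
    ring
  have hsmul : ∀ (z : ℂ) a, M (z • a) ≤ ‖z‖ * M a := fun z a => by
    simp only [M, map_smul, norm_smul]
    rw [Real.mul_rpow (norm_nonneg _) (norm_nonneg _), Real.mul_rpow (norm_nonneg _) (norm_nonneg _)]
    have : ‖z‖ ^ (1 - θ) * ‖z‖ ^ θ = ‖z‖ := by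
      rw [← Real.rpow_add' (norm_nonneg _) (by norm_num), sub_add_cancel, Real.rpow_one]
    rw [mul_mul_mul_comm, this]
  -- Growth rates of powers for the two norms interpolate geometrically to a growth rate for the
  -- hull.
  have hpow : ∀ (k₁ k₂ : ℝ), 0 ≤ k₁ → 0 ≤ k₂ → ∀ (a : A) (C₁ C₂ : ℝ), 0 ≤ C₁ → 0 ≤ C₂ →
      (∀ n : ℕ, ‖π₁ a ^ n‖ ≤ C₁ * k₁ ^ n) → (∀ n : ℕ, ‖π₂ a ^ n‖ ≤ C₂ * k₂ ^ n) → ∀ n : ℕ,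
      seminormHull M (a ^ n) ≤ C₁ ^ (1 - θ) * C₂ ^ θ * (k₁ ^ (1 - θ) * k₂ ^ θ) ^ n := by
    intro k₁ k₂ hk₁ hk₂ a C₁ C₂ hC₁ hC₂ ha₁ ha₂ n
    refine (seminormHull_le hM _).trans ?_
    simp only [M, map_pow]
    have e1 := Real.rpow_le_rpow (norm_nonneg _) (ha₁ n) hθ'.le
    have e2 := Real.rpow_le_rpow (norm_nonneg _) (ha₂ n) hθ.le
    refine (mul_le_mul e1 e2 (by positivity) (by positivity)).trans_eq ?_
    rw [Real.mul_rpow hC₁ (by positivity), Real.mul_rpow hC₂ (by positivity), mul_pow,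
      ← Real.rpow_pow_comm hk₁, ← Real.rpow_pow_comm hk₂]
    ring
  obtain ⟨s, hcs, hs⟩ := exists_spectral_value (ringSeminormHull M hM hmul hsmul)
    (seminormHull_smul_le hM hsmul) x hc0 (fun n => le_seminormHull (hlow n))
  have hs1 : ‖s‖ ≤ 1 := by
    have := hs X 1 1 zero_le_one fun n => by
      rw [aeval_X]
      refine (hpow 1 1 zero_le_one zero_le_one x 1 1 zero_le_one zero_le_one
        (by simpa using hn₁) (fun n => ?_) n).trans (by simp)
      simpa using (hn₂ n).trans (pow_le_one₀ hρ (hc.le.trans hc1))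
    simpa using this
  -- For `t` and `s.re` in `[-1, 1]` one has `(t - s.re) ^ 2 ≤ 4`, so `q` is nonnegative on `[-1,
  -- 1]`, with maximum `4` at `s.re`, whereas off the real axis `q s = 4 + s.im ^ 2`.
  let q : ℂ[X] := 4 - (X - C (s.re : ℂ)) ^ 2
  have hq : ∀ z, q.eval z = 4 - (z - s.re) ^ 2 := fun z => by simp [q]
  have hre : |s.re| ≤ 1 := (Complex.abs_re_le_norm s).trans hs1
  have hqr : ∀ t : ℝ, |t| ≤ 1 → ‖q.eval (t : ℂ)‖ = 4 - (t - s.re) ^ 2 := fun t ht => by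
    rw [hq, ← Complex.ofReal_sub, ← Complex.ofReal_pow,
      show (4 : ℂ) = ((4 : ℝ) : ℂ) by norm_num, ← Complex.ofReal_sub, Complex.norm_real,
      Real.norm_of_nonneg]
    have := abs_le.1 ht
    have := abs_le.1 hre
    nlinarith
  have hqs : ‖q.eval s‖ = 4 + s.im ^ 2 := by
    have h3 : s - s.re = s.im * Complex.I := by
      linear_combination -(Complex.re_add_im s)
    rw [hq, h3, mul_pow, Complex.I_sq,
      show (4 : ℂ) - s.im ^ 2 * -1 = ((4 + s.im ^ 2 : ℝ) : ℂ) by push_cast; ring,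
      Complex.norm_real, Real.norm_of_nonneg (by positivity)]
  have hb₁ : ∀ z ∈ spectrum ℂ (π₁ x), z = z.re ∧ |z.re| ≤ 1 := fun z hz =>
    ⟨Complex.ext rfl (by simp [h₁ z hz]), (Complex.abs_re_le_norm z).trans
      (norm_le_of_mem_spectrum_of_pow_le hz zero_le_one (C := 1) (by simpa using hn₁))⟩
  have hb₂ : ∀ z ∈ spectrum ℂ (π₂ x), z = z.re ∧ |z.re| ≤ ρ := fun z hz =>
    ⟨Complex.ext rfl (by simp [h₂ z hz]), (Complex.abs_re_le_norm z).trans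
      (norm_le_of_mem_spectrum_of_pow_le hz hρ (C := 1) (by simpa using hn₂))⟩
  -- The strict inequalities `4 < κ₁` and `r₂ < κ₂` are the slack that Gelfand's formula requires.
  have key : ∀ κ₂ r₂ : ℝ, 0 ≤ r₂ → r₂ < κ₂ → (∀ t : ℝ, |t| ≤ ρ → ‖q.eval (t : ℂ)‖ ≤ r₂) →
      ∀ κ₁ : ℝ, 4 < κ₁ → 4 + s.im ^ 2 ≤ κ₁ ^ (1 - θ) * κ₂ ^ θ := by
    intro κ₂ r₂ hr₂ hκ₂ hbd κ₁ hκ₁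
    obtain ⟨C₁, hC₁, hC₁'⟩ := norm_aeval_pow_le (π₁ x) q hκ₁ (by norm_num) fun z hz => by
      rw [(hb₁ z hz).1, hqr _ (hb₁ z hz).2]
      nlinarith [sq_nonneg (z.re - s.re)]
    obtain ⟨C₂, hC₂, hC₂'⟩ := norm_aeval_pow_le (π₂ x) q hκ₂ hr₂ fun z hz => by
      rw [(hb₂ z hz).1]
      exact hbd _ (hb₂ z hz).2
    have hκ₁0 : 0 ≤ κ₁ := by linarith
    have hκ₂0 : 0 ≤ κ₂ := by linarith
    rw [← hqs]
    refine hs q _ _ (by positivity) (hpow κ₁ κ₂ hκ₁0 hκ₂0 (aeval x q) C₁ C₂ hC₁ hC₂ ?_ ?_)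
    · simpa only [aeval_algHom_apply] using hC₁'
    · simpa only [aeval_algHom_apply] using hC₂'
  have hρ1 : ρ ≤ 1 := hc.le.trans hc1
  -- Bounding `q` by `4` on both spectra suffices here: equal rates `4 + s.im ^ 2 / 2` make the
  -- exponents add up to one.
  have him : s.im = 0 := by
    by_contra him
    have hp : 0 < s.im ^ 2 := by positivity
    have h5 := key (4 + s.im ^ 2 / 2) 4 (by norm_num) (by linarith) (fun t ht => by
      rw [hqr t (ht.trans hρ1)]
      nlinarith [sq_nonneg (t - s.re)]) (4 + s.im ^ 2 / 2) (by linarith)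
    rw [← Real.rpow_add (by positivity), sub_add_cancel, Real.rpow_one] at h5
    linarith
  have hsre : c ≤ |s.re| := by
    have h6 : s = s.re := Complex.ext rfl (by simp [him])
    rwa [h6, Complex.norm_real] at hcs
  -- Now `s` is real with `|s| ≥ c > ρ`, so on `[-ρ, ρ]` the polynomial stays below its peak by at
  -- least `d = (c - ρ) ^ 2`; half of `d` is spent on the slack.
  obtain ⟨d, hd, hd4⟩ : ∃ d, 0 < d ∧ d = (c - ρ) ^ 2 := ⟨_, by nlinarith, rfl⟩
  have hd1 : d ≤ 1 := by nlinarith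
  have h7 := key (4 - d / 2) (4 - d) (by linarith) (by linarith) fun t ht => by
    rw [hqr t (ht.trans hρ1), hd4]
    have h8 : c - ρ ≤ |t - s.re| := by
      have := abs_sub_abs_le_abs_sub s.re t
      rw [abs_sub_comm] at this
      linarith
    have := pow_le_pow_left₀ (by linarith) h8 2
    rw [sq_abs] at this
    linarith
  have hlim : Filter.Tendsto (fun κ : ℝ => κ ^ (1 - θ) * (4 - d / 2) ^ θ)
      (nhdsWithin 4 (Set.Ioi 4)) (nhds ((4 : ℝ) ^ (1 - θ) * (4 - d / 2) ^ θ)) :=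
    (((Real.continuousAt_rpow_const 4 (1 - θ) (Or.inl (by norm_num))).tendsto).mono_left
      nhdsWithin_le_nhds).mul_const _
  have h9 : 4 + s.im ^ 2 ≤ (4 : ℝ) ^ (1 - θ) * (4 - d / 2) ^ θ :=
    ge_of_tendsto hlim (by filter_upwards [self_mem_nhdsWithin] with κ hκ using h7 κ hκ)
  have h10 : (4 : ℝ) ^ (1 - θ) * (4 - d / 2) ^ θ < (4 : ℝ) ^ (1 - θ) * (4 : ℝ) ^ θ :=
    mul_lt_mul_of_pos_left (Real.rpow_lt_rpow (by linarith) (by linarith) hθ) (by positivity)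
  rw [← Real.rpow_add (by norm_num), sub_add_cancel, Real.rpow_one] at h10
  rw [him] at h9
  linarith

end Spectral

/-! ### Invariant means from almost invariant vectors in `ℓ²` -/

section VectorState

variable {X : Type*}

/-- Pointwise multiplication `ℓ^∞(X) × ℓ²(X) → ℓ²(X)`. -/
def multiply (X : Type*) :
    lp (fun _ : X => ℂ) ∞ →L[ℂ] lp (fun _ : X => ℂ) 2 →L[ℂ] lp (fun _ : X => ℂ) 2 :=
  lp.holderL (p := ∞) (q := 2) 2 (fun _ : X => ContinuousLinearMap.mul ℂ ℂ) (K := 1)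
    (fun _ => by simp)

theorem multiply_apply (φ : lp (fun _ : X => ℂ) ∞) (ξ : lp (fun _ : X => ℂ) 2) (x : X) :
    multiply X φ ξ x = φ x * ξ x := rfl

theorem norm_multiply_le (φ : lp (fun _ : X => ℂ) ∞) (ξ : lp (fun _ : X => ℂ) 2) :
    ‖multiply X φ ξ‖ ≤ ‖φ‖ * ‖ξ‖ := by
  have h : ‖multiply X‖ ≤ ((1 : NNReal) : ℝ) := lp.norm_holderL_le (p := ∞) (q := 2) 2
    (fun _ : X => ContinuousLinearMap.mul ℂ ℂ) (K := 1) (fun _ => by simp)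
  have h2 := (multiply X).le_of_opNorm₂_le_of_le h (le_refl ‖φ‖) (le_refl ‖ξ‖)
  simpa using h2

/-- The functional `φ ↦ ⟨φ ξ, ξ⟩` on `ℓ^∞(X)`. -/
def vectorState (ξ : lp (fun _ : X => ℂ) 2) : lp (fun _ : X => ℂ) ∞ →L[ℂ] ℂ :=
  (innerSL ℂ ξ).comp ((multiply X).flip ξ)

theorem vectorState_apply (ξ : lp (fun _ : X => ℂ) 2) (φ : lp (fun _ : X => ℂ) ∞) :
    vectorState ξ φ = inner ℂ ξ (multiply X φ ξ) := rfl

theorem norm_vectorState_le {ξ : lp (fun _ : X => ℂ) 2} (hξ : ‖ξ‖ = 1) : ‖vectorState ξ‖ ≤ 1 := by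
  refine ContinuousLinearMap.opNorm_le_bound _ zero_le_one fun φ => ?_
  rw [vectorState_apply]
  refine (norm_inner_le_norm _ _).trans ?_
  have := norm_multiply_le φ ξ
  rw [hξ] at this ⊢
  linarith

theorem vectorState_one {ξ : lp (fun _ : X => ℂ) 2} (hξ : ‖ξ‖ = 1) : vectorState ξ 1 = 1 := by
  have h : multiply X 1 ξ = ξ := by
    ext x
    rw [multiply_apply, lp.infty_coeFn_one, Pi.one_apply, one_mul]
  rw [vectorState_apply, h, inner_self_eq_norm_sq_to_K, hξ]
  simp

theorem vectorState_nonneg (ξ : lp (fun _ : X => ℂ) 2) {φ : lp (fun _ : X => ℂ) ∞}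
    (hφ : ∀ x, 0 ≤ φ x) : 0 ≤ vectorState ξ φ := by
  refine (lp.hasSum_inner ξ (multiply X φ ξ)).nonneg fun x => ?_
  rw [multiply_apply, RCLike.inner_apply, mul_assoc]
  exact mul_nonneg (hφ x) (mul_star_self_nonneg (ξ x))

theorem norm_vectorState_sub_le {ξ η : lp (fun _ : X => ℂ) 2} (hξ : ‖ξ‖ = 1) (hη : ‖η‖ = 1)
    (φ : lp (fun _ : X => ℂ) ∞) :
    ‖vectorState ξ φ - vectorState η φ‖ ≤ 2 * ‖φ‖ * ‖ξ - η‖ := by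
  have h : vectorState ξ φ - vectorState η φ
      = inner ℂ (ξ - η) (multiply X φ ξ) + inner ℂ η (multiply X φ (ξ - η)) := by
    rw [vectorState_apply, vectorState_apply, map_sub, inner_sub_left, inner_sub_right]
    ring
  have h1 := (norm_inner_le_norm (𝕜 := ℂ) (ξ - η) (multiply X φ ξ)).trans
    (mul_le_mul_of_nonneg_left (norm_multiply_le φ ξ) (norm_nonneg _))
  have h2 := (norm_inner_le_norm (𝕜 := ℂ) η (multiply X φ (ξ - η))).trans
    (mul_le_mul_of_nonneg_left (norm_multiply_le φ (ξ - η)) (norm_nonneg _))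
  rw [hξ] at h1
  rw [hη] at h2
  rw [h]
  refine (norm_add_le _ _).trans ?_
  linarith

variable {G : Type*} [Group G] [MulAction G X]

theorem translate_translate_inv (p : ℝ≥0∞) [Fact (1 ≤ p)] (y : G) (g : lp (fun _ : X => ℂ) p) :
    translate p y (translate p y⁻¹ g) = g := by
  ext x
  rw [translate_apply, translate_apply, inv_inv, smul_inv_smul]

theorem vectorState_translate (ξ : lp (fun _ : X => ℂ) 2) (φ : lp (fun _ : X => ℂ) ∞) (y : G) :
    vectorState ξ (translate ∞ y φ) = vectorState (translate 2 y⁻¹ ξ) φ := by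
  rw [vectorState_apply, vectorState_apply, ← (translate 2 y⁻¹).inner_map_map]
  congr 1
  ext x
  rw [multiply_apply, translate_apply, translate_apply, multiply_apply, translate_apply, inv_inv,
    inv_smul_smul]

/-- The vector states of almost invariant unit vectors are almost invariant means; by Banach–Alaoglu
they have a weak-* limit along an ultrafilter, which is an invariant mean. -/
theorem isCoamenable_of_almost_invariant (H : Subgroup G)
    (h : ∀ (F : Finset G) (ε : ℝ), 0 < ε → ∃ ξ : lp (fun _ : G ⧸ H => ℂ) 2, ‖ξ‖ = 1 ∧
      ∀ y ∈ F, ‖translate 2 y ξ - ξ‖ ≤ ε) : IsCoamenable H := by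
  classical
  choose ξ hξ hF using fun i : Finset G × ℕ => h i.1 (1 / ((i.2 : ℝ) + 1)) (by positivity)
  let m : Finset G × ℕ → WeakDual ℂ (lp (fun _ : G ⧸ H => ℂ) ∞) :=
    fun i => StrongDual.toWeakDual (vectorState (ξ i))
  let 𝒰 : Ultrafilter (Finset G × ℕ) := Ultrafilter.of Filter.atTop
  have hm : ∀ i, m i ∈ WeakDual.toStrongDual ⁻¹' Metric.closedBall
      (0 : StrongDual ℂ (lp (fun _ : G ⧸ H => ℂ) ∞)) 1 := fun i => by
    rw [Set.mem_preimage, mem_closedBall_zero_iff]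
    exact norm_vectorState_le (hξ i)
  obtain ⟨M, -, hM⟩ := (WeakDual.isCompact_closedBall
    (0 : StrongDual ℂ (lp (fun _ : G ⧸ H => ℂ) ∞)) 1).ultrafilter_le_nhds (𝒰.map m)
    (Filter.le_principal_iff.2 (Ultrafilter.mem_map.2 (Filter.univ_mem' hm)))
  have hlim : ∀ φ, Filter.Tendsto (fun i => vectorState (ξ i) φ) 𝒰 (nhds (M φ)) := fun φ =>
    ((WeakDual.eval_continuous φ).tendsto M).comp hM
  refine ⟨WeakDual.toStrongDual M, ?_, fun φ hφ => ?_, fun y φ => ?_⟩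
  · refine tendsto_nhds_unique (hlim 1) (tendsto_const_nhds.congr fun i => ?_)
    rw [vectorState_one (hξ i)]
  · exact ge_of_tendsto' (hlim φ) fun i => vectorState_nonneg _ hφ
  · have h1 := (hlim (translate ∞ y φ)).sub (hlim φ)
    refine sub_eq_zero.1 (tendsto_nhds_unique h1 ?_)
    have h0 : Filter.Tendsto (fun i : Finset G × ℕ => 2 * ‖φ‖ * (1 / ((i.2 : ℝ) + 1)))
        Filter.atTop (nhds 0) := by
      rw [← Filter.prod_atTop_atTop_eq]
      simpa using ((tendsto_one_div_add_atTop_nhds_zero_nat (𝕜 := ℝ)).comp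
        Filter.tendsto_snd).const_mul (2 * ‖φ‖)
    refine squeeze_zero_norm' ?_ (h0.mono_left (Ultrafilter.of_le _))
    refine Ultrafilter.of_le _ ?_
    -- Translating `φ` by `y` amounts to translating the vector by `y⁻¹`, so it is `y⁻¹` that the
    -- finite set must contain.
    filter_upwards [Filter.eventually_ge_atTop (({y⁻¹}, 0) : Finset G × ℕ)] with i hi
    rw [vectorState_translate]
    refine (norm_vectorState_sub_le ((LinearIsometry.norm_map _ _).trans (hξ i)) (hξ i) φ).trans ?_
    exact mul_le_mul_of_nonneg_left (hF i _ (hi.1 (Finset.mem_singleton_self _))) (by positivity)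

end VectorState

/-! ### Uniform averages and a Kesten-type criterion for co-amenability -/

section Average

variable {G : Type*} [Group G]

/-- The uniform probability measure on a finite subset of `G`. -/
def average (F : Finset G) : L1 G := ((F.card : ℂ)⁻¹) • ∑ y ∈ F, L1.single y

theorem average_mem_groupAlgebra (F : Finset G) : average F ∈ L1.groupAlgebra G := by
  refine Subalgebra.smul_mem _ (Subalgebra.sum_mem _ fun y _ => ?_) _
  refine (Set.finite_singleton y).subset fun x hx => ?_
  by_contra hn
  exact hx (L1.single_apply_ne hn)

theorem star_single (y : G) : star (L1.single y) = L1.single y⁻¹ := by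
  refine L1.ext fun x => ?_
  rw [L1.star_apply]
  by_cases h : x = y⁻¹
  · rw [h, inv_inv, L1.single_apply_self, L1.single_apply_self, star_one]
  · rw [L1.single_apply_ne h, L1.single_apply_ne (fun h' => h (by rw [← h', inv_inv])), star_zero]

theorem isSelfAdjoint_average {F : Finset G} (hF : ∀ y ∈ F, y⁻¹ ∈ F) :
    IsSelfAdjoint (average F) := by
  rw [IsSelfAdjoint, average, star_smul, star_sum]
  simp only [star_single, star_inv₀, star_natCast]
  congr 1
  exact Finset.sum_bij' (fun y _ => y⁻¹) (fun y _ => y⁻¹) hF hF (by simp) (by simp) (by simp)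

variable {X : Type*} [MulAction G X] (p : ℝ≥0∞) [Fact (1 ≤ p)]

theorem lam_average_apply (F : Finset G) (g : lp (fun _ : X => ℂ) p) :
    lam X p (average F) g = ((F.card : ℂ)⁻¹) • ∑ y ∈ F, translate p y g := by
  rw [average, map_smul, map_sum, smul_apply, sum_apply]
  simp only [lam_single]
  rfl

theorem norm_lam_average_le (F : Finset G) : ‖lam X p (average F)‖ ≤ 1 := by
  refine ContinuousLinearMap.opNorm_le_bound _ zero_le_one fun g => ?_
  rw [lam_average_apply, norm_smul, norm_inv, Complex.norm_natCast, one_mul]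
  have h := norm_sum_le F fun y => translate p y g
  simp only [LinearIsometry.norm_map, Finset.sum_const, nsmul_eq_mul] at h
  refine (mul_le_mul_of_nonneg_left h (by positivity)).trans ?_
  rw [← mul_assoc]
  exact mul_le_of_le_one_left (norm_nonneg g) (inv_mul_le_one)

theorem isSelfAdjoint_lam_average {F : Finset G} (hF : ∀ y ∈ F, y⁻¹ ∈ F) :
    IsSelfAdjoint (lam X 2 (average F)) := by
  rw [ContinuousLinearMap.isSelfAdjoint_iff_isSymmetric]
  intro g h
  have ht : ∀ y : G, inner ℂ (translate 2 y g) h = inner ℂ g (translate 2 y⁻¹ h) := fun y => by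
    rw [← (translate 2 y).inner_map_map g, translate_translate_inv]
  simp only [ContinuousLinearMap.coe_coe, lam_average_apply, inner_smul_left, inner_smul_right,
    map_inv₀, map_natCast, sum_inner, inner_sum, ht]
  congr 1
  exact Finset.sum_bij' (fun y _ => y⁻¹) (fun y _ => y⁻¹) hF hF (by simp) (by simp) (by simp)

/-- A unit vector on which the average is almost isometric is almost invariant. -/
theorem norm_translate_sub_sq_le {F : Finset G} (h1 : 1 ∈ F) {y : G} (hy : y ∈ F)
    {ξ : lp (fun _ : X => ℂ) 2} (hξ : ‖ξ‖ = 1) {δ : ℝ} (hδ1 : F.card * δ ≤ 1)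
    (h : 1 - δ ≤ ‖lam X 2 (average F) ξ‖) :
    ‖translate 2 y ξ - ξ‖ ^ 2 ≤ 4 * (F.card * δ) := by
  classical
  have hn : ∀ z : G, ‖translate 2 z ξ‖ = 1 := fun z => (LinearIsometry.norm_map _ _).trans hξ
  have ht1 : translate 2 (1 : G) ξ = ξ := by
    ext x
    rw [translate_apply, inv_one, one_smul]
  have hc : 0 < (F.card : ℝ) := by exact_mod_cast Finset.card_pos.2 ⟨1, h1⟩
  rw [lam_average_apply, norm_smul, norm_inv, Complex.norm_natCast, inv_mul_eq_div,
    le_div_iff₀ hc] at h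
  rcases eq_or_ne y 1 with rfl | hy1
  -- For `y = 1` the left side vanishes and only `0 ≤ δ` is needed; the main argument removes two
  -- distinct elements from `F`.
  · have hδ : 0 ≤ δ := by
      have := norm_sum_le F fun y => translate 2 y ξ
      simp only [hn, Finset.sum_const, nsmul_eq_mul, mul_one] at this
      have h5 : 0 ≤ δ * F.card := by linarith
      exact nonneg_of_mul_nonneg_left h5 hc
    rw [ht1, sub_self, norm_zero, zero_pow two_ne_zero]
    positivity
  have hy' : y ∈ F.erase 1 := Finset.mem_erase.2 ⟨hy1, hy⟩
  have hcard : (((F.erase 1).erase y).card : ℝ) = F.card - 2 := by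
    have e1 := Finset.card_erase_add_one h1
    have e2 := Finset.card_erase_add_one hy'
    rw [← e1, ← e2]
    push_cast
    ring
  -- The terms of `y` and `1` are kept together; the other `F.card - 2` terms are unit vectors, so
  -- nearly maximal length of the sum makes `‖translate 2 y ξ + ξ‖` close to `2`.
  have hsum : ‖∑ z ∈ F, translate 2 z ξ‖ ≤ ‖translate 2 y ξ + ξ‖ + (F.card - 2) := by
    rw [← Finset.add_sum_erase F _ h1, ← Finset.add_sum_erase _ _ hy', ht1, ← add_assoc,
      add_comm ξ]
    refine (norm_add_le _ _).trans (add_le_add_right ?_ _)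
    refine (norm_sum_le _ _).trans_eq ?_
    simp only [hn, Finset.sum_const, nsmul_eq_mul, mul_one, hcard]
  have hlow : 2 - F.card * δ ≤ ‖translate 2 y ξ + ξ‖ := by linarith
  -- The parallelogram law gives `‖yξ - ξ‖² = 4 - ‖yξ + ξ‖² ≤ 4 - (2 - F.card * δ)² ≤ 4 * (F.card *
  -- δ)`; `hδ1` makes the squared quantity nonnegative.
  have hpar := parallelogram_law_with_norm ℂ (translate 2 y ξ) ξ
  rw [hn, hξ] at hpar
  nlinarith [mul_self_le_mul_self (by linarith) hlow]

/-- If every such average had norm at least `1`, nearly norming vectors for the average over a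
symmetric set containing `1` and a given `E` would be almost invariant under `E`. -/
theorem exists_norm_lam_average_lt_one (H : Subgroup G) (hH : ¬ IsCoamenable H) :
    ∃ F : Finset G, 1 ∈ F ∧ (∀ y ∈ F, y⁻¹ ∈ F) ∧ ‖lam (G ⧸ H) 2 (average F)‖ < 1 := by
  classical
  by_contra! hcon
  refine hH (isCoamenable_of_almost_invariant H fun E ε hε => ?_)
  let F : Finset G := insert 1 (E ∪ E.image fun y => y⁻¹)
  have h1 : 1 ∈ F := Finset.mem_insert_self _ _
  have hinv : ∀ y ∈ F, y⁻¹ ∈ F := fun y hy => by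
    simp only [F, Finset.mem_insert, Finset.mem_union, Finset.mem_image] at hy ⊢
    rcases hy with rfl | hy | ⟨z, hz, rfl⟩
    · simp
    · exact Or.inr (Or.inr ⟨y, hy, rfl⟩)
    · simp [hz]
  have hc : 0 < (F.card : ℝ) := by exact_mod_cast Finset.card_pos.2 ⟨1, h1⟩
  obtain ⟨δ, hδ, hδ1, hδε⟩ : ∃ δ : ℝ, 0 < δ ∧ F.card * δ ≤ 1 ∧ 4 * (F.card * δ) ≤ ε ^ 2 := by
    refine ⟨min 1 (ε ^ 2 / 4) / F.card, by positivity, ?_, ?_⟩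
    · rw [mul_div_cancel₀ _ hc.ne']
      exact min_le_left _ _
    · rw [mul_div_cancel₀ _ hc.ne']
      linarith [min_le_right 1 (ε ^ 2 / 4)]
  have hlt : Real.toNNReal (1 - δ) < ‖lam (G ⧸ H) 2 (average F)‖₊ := by
    rw [← NNReal.coe_lt_coe, coe_nnnorm]
    refine lt_of_lt_of_le ?_ (hcon F h1 hinv)
    rw [Real.coe_toNNReal']
    exact max_lt (by linarith) one_pos
  obtain ⟨ξ, hξ, hξ'⟩ :=
    ContinuousLinearMap.exists_nnnorm_eq_one_lt_apply_of_lt_opNNNorm _ hlt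
  have hξ1 : ‖ξ‖ = 1 := by rw [← coe_nnnorm, hξ, NNReal.coe_one]
  refine ⟨ξ, hξ1, fun y hy => ?_⟩
  have hyF : y ∈ F := Finset.mem_insert_of_mem (Finset.mem_union_left _ hy)
  have hb : 1 - δ ≤ ‖lam (G ⧸ H) 2 (average F) ξ‖ := by
    rw [← coe_nnnorm]
    exact (Real.le_coe_toNNReal _).trans (NNReal.coe_le_coe.2 hξ'.le)
  exact le_of_sq_le_sq ((norm_translate_sub_sq_le h1 hyF hξ1 hδ1 hb).trans hδε) hε.le

end Average

/-! ### Slow decay of powers of an average in the interpolated norm -/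

section LowerBound

open Pointwise

variable {G : Type*} [Group G] {X : Type*} [MulAction G X]

/-- The functional `f ↦ ∑_{x ∈ S} (f · δ_o)(x)` on `ℓ¹(G)`. -/
def columnSum (S : Finset X) (o : X) : L1 G →ₗ[ℂ] ℂ := by
  classical exact ∑ x ∈ S, ((lp.evalCLM ℂ (fun _ : X => ℂ) 2 x).comp
    ((ContinuousLinearMap.apply ℂ (lp (fun _ : X => ℂ) 2) (lp.single 2 o 1)).comp
      (lam X 2))).toLinearMap

theorem columnSum_apply (S : Finset X) (o : X) (f : L1 G) :
    columnSum S o f = ∑ x ∈ S, entry f x o := by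
  classical
  rw [columnSum, LinearMap.sum_apply]
  exact Finset.sum_congr rfl fun x _ => lam_single_apply 2 f x o

theorem columnSum_single {S : Finset X} {o : X} {y : G} (h : y • o ∈ S) :
    columnSum S o (L1.single y) = 1 := by
  classical
  have he : ∀ x, entry (L1.single y) x o = if x = y • o then 1 else 0 := fun x => by
    rw [← lam_single_apply 2, lam_single]
    change lp.single (E := fun _ : X => ℂ) 2 o 1 (y⁻¹ • x) = _
    rw [lp.single_apply, Pi.single_apply]
    simp only [inv_smul_eq_iff]
  rw [columnSum_apply]
  simp only [he, Finset.sum_ite_eq', h, if_true]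

theorem norm_columnSum_le_one (S : Finset X) (o : X) (f : L1 G) :
    ‖columnSum S o f‖ ≤ ‖lam X 1 f‖ := by
  obtain ⟨s, hs, hsum⟩ := hasSum_norm_entry f o
  rw [columnSum_apply]
  exact (norm_sum_le _ _).trans ((sum_le_hasSum S (fun _ _ => norm_nonneg _) hsum).trans hs)

/-- Cauchy–Schwarz on the `S.card` entries of the column at `o`, whose `ℓ²` norm is at most the
operator norm. -/
theorem norm_columnSum_le_two (S : Finset X) (o : X) (f : L1 G) :
    ‖columnSum S o f‖ ≤ Real.sqrt S.card * ‖lam X 2 f‖ := by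
  classical
  have h1 : ∑ x ∈ S, ‖entry f x o‖ ^ 2 ≤ ‖lam X 2 f‖ ^ 2 := by
    have h := lp.sum_rpow_le_norm_rpow (p := 2) (by simp) (lam X 2 f (lp.single 2 o 1)) S
    simp only [lam_single_apply, ENNReal.toReal_ofNat, Real.rpow_ofNat] at h
    refine h.trans (pow_le_pow_left₀ (norm_nonneg _) ?_ 2)
    have h2 := (lam X 2 f).le_opNorm (lp.single 2 o 1)
    rwa [lp.norm_single (by simp), norm_one, mul_one] at h2
  rw [columnSum_apply]
  refine (norm_sum_le _ _).trans ?_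
  refine le_of_sq_le_sq ?_ (by positivity)
  rw [mul_pow, Real.sq_sqrt (Nat.cast_nonneg _)]
  exact (sq_sum_le_card_mul_sum_sq).trans (mul_le_mul_of_nonneg_left h1 (Nat.cast_nonneg _))

theorem linearMap_average_pow [DecidableEq G] {F : Finset G} (hF : F.Nonempty) (n : ℕ)
    (ℓ : L1 G →ₗ[ℂ] ℂ) (h : ∀ y ∈ F ^ n, ℓ (L1.single y) = 1) : ℓ (average F ^ n) = 1 := by
  induction n generalizing ℓ with
  | zero =>
    rw [pow_zero]
    exact h 1 (by simp)
  | succ n ih =>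
    rw [pow_succ']
    -- The induction hypothesis is applied to `ℓ` precomposed with multiplication by the average: at
    -- `z ∈ F ^ n` this is the mean of the values of `ℓ` at `y * z ∈ F ^ (n + 1)`, all equal to `1`.
    refine ih (ℓ.comp (LinearMap.mulLeft ℂ (average F))) fun z hz => ?_
    have hc : (F.card : ℂ) ≠ 0 := by exact_mod_cast hF.card_pos.ne'
    rw [LinearMap.comp_apply, LinearMap.mulLeft_apply, average, smul_mul_assoc, Finset.sum_mul,
      map_smul, map_sum, Finset.sum_congr rfl fun y hy => ?_, Finset.sum_const, nsmul_eq_mul,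
      mul_one, smul_eq_mul, inv_mul_cancel₀ hc]
    rw [L1.single_mul_single]
    exact h _ (pow_succ' F n ▸ Finset.mul_mem_mul hy hz)

/-- Decompositions of the powers of an average decay slowly in the interpolated norm, as the
orbit of a point under the powers of a finite set grows at most exponentially. -/
theorem pow_le_sum_interpolated (F : Finset G) (hF : F.Nonempty) (o : X) {θ : ℝ} (hθ : 0 ≤ θ)
    (hθ1 : θ ≤ 1) (N : L1 G → ℝ) (hN : ∀ a, ‖lam X 1 a‖ ≤ N a) (n : ℕ) (l : List (L1 G))
    (hl : l.sum = average F ^ n) :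
    ((F.card : ℝ) ^ (-θ / 2)) ^ n ≤
      (l.map fun a => N a ^ (1 - θ) * ‖lam X 2 a‖ ^ θ).sum := by
  classical
  have hc : 0 < (F.card : ℝ) := by exact_mod_cast hF.card_pos
  let S : Finset X := (F ^ n).image fun y => y • o
  have hS : (S.card : ℝ) ≤ (F.card : ℝ) ^ n := by
    exact_mod_cast Finset.card_image_le.trans Finset.card_pow_le
  have hsum : columnSum S o (average F ^ n) = 1 :=
    linearMap_average_pow hF n _ fun y hy =>
      columnSum_single (Finset.mem_image_of_mem (fun y => y • o) hy)
  -- This is `√(|F|ⁿ) ^ θ`, the Cauchy–Schwarz loss after interpolating the `ℓ¹` and `ℓ²` bounds for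
  -- the column sum.
  let K : ℝ := ((F.card : ℝ) ^ (θ / 2)) ^ n
  have hterm : ∀ a : L1 G, ‖columnSum S o a‖ ≤ K * (N a ^ (1 - θ) * ‖lam X 2 a‖ ^ θ) := fun a => by
    have hNa : 0 ≤ N a := (norm_nonneg _).trans (hN a)
    have h1 : ‖columnSum S o a‖ ≤ N a := (norm_columnSum_le_one S o a).trans (hN a)
    have h2 : ‖columnSum S o a‖ ≤ Real.sqrt ((F.card : ℝ) ^ n) * ‖lam X 2 a‖ :=
      (norm_columnSum_le_two S o a).trans
        (mul_le_mul_of_nonneg_right (Real.sqrt_le_sqrt hS) (norm_nonneg _))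
    have h3 : ‖columnSum S o a‖ = ‖columnSum S o a‖ ^ (1 - θ) * ‖columnSum S o a‖ ^ θ := by
      rw [← Real.rpow_add' (norm_nonneg _) (by norm_num), sub_add_cancel, Real.rpow_one]
    have h4 : Real.sqrt ((F.card : ℝ) ^ n) ^ θ = K := by
      simp only [K]
      rw [Real.sqrt_eq_rpow, ← Real.rpow_mul (by positivity), ← Real.rpow_natCast,
        ← Real.rpow_mul hc.le, ← Real.rpow_natCast, ← Real.rpow_mul hc.le]
      congr 1
      ring
    rw [h3]
    refine (mul_le_mul (Real.rpow_le_rpow (norm_nonneg _) h1 (by linarith))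
      (Real.rpow_le_rpow (norm_nonneg _) h2 hθ) (by positivity) (by positivity)).trans_eq ?_
    rw [Real.mul_rpow (Real.sqrt_nonneg _) (norm_nonneg _), h4]
    ring
  have hall : ∀ l : List (L1 G), ‖columnSum S o l.sum‖ ≤
      K * (l.map fun a => N a ^ (1 - θ) * ‖lam X 2 a‖ ^ θ).sum := fun l => by
    induction l with
    | nil => simp
    | cons a l ih =>
      rw [List.sum_cons, List.map_cons, List.sum_cons, map_add, mul_add]
      exact (norm_add_le _ _).trans (add_le_add (hterm a) ih)
  have h := hall l
  rw [hl, hsum, norm_one] at h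
  have hK : ((F.card : ℝ) ^ (-θ / 2)) ^ n * K = 1 := by
    rw [← mul_pow, ← Real.rpow_add hc]
    ring_nf
    simp
  calc ((F.card : ℝ) ^ (-θ / 2)) ^ n = ((F.card : ℝ) ^ (-θ / 2)) ^ n * 1 := (mul_one _).symm
    _ ≤ ((F.card : ℝ) ^ (-θ / 2)) ^ n * (K * (l.map fun a => N a ^ (1 - θ) * ‖lam X 2 a‖ ^ θ).sum) :=
      mul_le_mul_of_nonneg_left h (by positivity)
    _ = _ := by rw [← mul_assoc, hK, one_mul]

/-- As `θ → 0` the power tends to `1 > ρ`, so the lower decay rate beats the `ℓ²` norm for small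
`θ`. -/
theorem exists_exponent {k ρ : ℝ} (hk : 0 < k) (hρ : ρ < 1) :
    ∃ θ : ℝ, 0 < θ ∧ θ < 1 ∧ ρ < k ^ (-θ / 2) := by
  have hcont : Continuous fun θ : ℝ => k ^ (-θ / 2) :=
    Continuous.rpow continuous_const (by fun_prop) fun _ => Or.inl hk.ne'
  have h0 : ∀ᶠ θ in nhdsWithin (0 : ℝ) (Set.Ioi 0), ρ < k ^ (-θ / 2) := by
    refine nhdsWithin_le_nhds ((hcont.tendsto 0).eventually_const_lt ?_)
    simpa using hρ
  have h1 : ∀ᶠ θ in nhdsWithin (0 : ℝ) (Set.Ioi 0), θ < 1 :=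
    nhdsWithin_le_nhds (eventually_lt_nhds one_pos)
  obtain ⟨θ, hθ, hθ1, hθ2⟩ := (h0.and (h1.and self_mem_nhdsWithin)).exists
  exact ⟨θ, hθ2, hθ1, hθ⟩

end LowerBound

end GroupPair

end

/-! ### The contradiction when `H` is not co-amenable -/

theorem theoremA {G : Type*} [Group G] (H : Subgroup G)
    (hGH : GroupPair.IsQuasiHermitianPair H) : GroupPair.IsCoamenable H := by
  open GroupPair in
  by_contra hH
  obtain ⟨F, h1, hinv, hρ⟩ := exists_norm_lam_average_lt_one H hH
  have hF : F.Nonempty := ⟨1, h1⟩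
  have hc : 1 ≤ (F.card : ℝ) := by exact_mod_cast hF.card_pos
  obtain ⟨θ, hθ, hθ1, hlow⟩ := exists_exponent (one_pos.trans_le hc) hρ
  have hn1 : ‖PF1.ofL1Pair H (L1Pair.mk H (average F))‖ ≤ 1 := by
    rw [PF1.norm_ofL1Pair, L1Pair.norm_mk]
    exact max_le (norm_lam_average_le 1 F) (norm_lam_average_le ⊤ F)
  have hpow : ∀ {R : Type _} [NormedRing R] (a : R) (r : ℝ), ‖(1 : R)‖ ≤ 1 → ‖a‖ ≤ r →
      ∀ n : ℕ, ‖a ^ n‖ ≤ r ^ n := by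
    intro R _ a r h1 ha n
    induction n with
    | zero => simpa using h1
    | succ n ih =>
      rw [pow_succ, pow_succ]
      exact (norm_mul_le _ _).trans (mul_le_mul ih ha (norm_nonneg _)
        ((norm_nonneg _).trans ih))
  refine false_of_interpolation ((PF1.ofL1Pair H).comp (L1Pair.mk H)) (lamHom (G ⧸ H) 2)
    (average F) hθ hθ1 ?_ (fun z hz => ?_) (fun n => ?_) (hpow _ _ ?_ le_rfl) (norm_nonneg _) hlow
    (Real.rpow_le_one_of_one_le_of_nonpos hc (by linarith)) fun n l hl => ?_
  · refine hGH _ ⟨average F, average_mem_groupAlgebra F, rfl⟩ ?_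
    exact (isSelfAdjoint_average hinv).map ((PF1.ofL1PairStar H).comp (L1Pair.mkStar H))
  · exact (isSelfAdjoint_lam_average hinv).im_eq_zero_of_mem_spectrum hz
  · refine (hpow _ _ ?_ hn1 n).trans (by simp)
    rw [← map_one (PF1.ofL1Pair H), ← map_one (L1Pair.mk H), PF1.norm_ofL1Pair, L1Pair.norm_mk,
      lam_one, lam_one]
    exact max_le ContinuousLinearMap.norm_id_le ContinuousLinearMap.norm_id_le
  · exact ContinuousLinearMap.norm_id_le
  -- The base point is the coset of `1`; the `PF1` norm serves as `N`, since it dominates the norm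
  -- on `ℓ¹(G/H)`.
  · refine pow_le_sum_interpolated (X := G ⧸ H) F hF ((1 : G) : G ⧸ H) hθ.le hθ1.le _ (fun a => ?_)
      n l hl
    rw [AlgHom.comp_apply, PF1.norm_ofL1Pair, L1Pair.norm_mk]
    exact le_max_left _ _
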